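/- **Setting.** Define $a_0=\tfrac52$ and $2(k+1)(4k^2+\tfrac54)a_{k+1}+(2k-1)a_k=0$ for $k\ge 0$ (so $a_1=1$), and let $X_0(x)=\sum_{k\ge0}a_kx^{2k}=\tfrac52+x^2-\tfrac1{21}x^4+\cdots$, an entire function; $X_0'/x$ denotes the analytic function with value $2$ at $x=0$. Put $h(x,y)=2X_0-xX_0'+y^2X_0'/x+\sqrt5$ and, on $D=\{(x,y)\in\mathbb R^2: x>0\}$, $$a_1=\tfrac{2y}{xh}\bigl(X_0+\tfrac{\sqrt5}2\bigr),\quad b_1=-\tfrac{1}{xh}\bigl(X_0+\tfrac{\sqrt5}2+\sqrt5(x^2-y^2)\bigr),\quad c_1=-\tfrac{2}{xh}\bigl(X_0+\tfrac{\sqrt5}2\bigr),$$ $$a_2=-\tfrac1h\bigl(2X_0+\sqrt5-(x^2+y^2)\tfrac{X_0'}x\bigr),\quad b_2=-\tfrac{2y}h\bigl(\tfrac{X_0'}{2x}+\sqrt5\bigr),\quad c_2=\tfrac{2y}h\bigl(X_0''-\tfrac{X_0'}x\bigr)$$ (in these formulas $a_1,a_2$ are functions, not coefficients of $X_0$). Let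 $F^0=[\phi,X^0_\alpha,X^0_\beta,\xi]$ be an orthonormal frame field of $\mathbb R^4$ on $D$ solving the structure equation $$\phi_x=-a_1X^0_\alpha,\quad (X^0_\alpha)_x=a_1\phi-c_1X^0_\beta-b_1\xi,\quad (X^0_\beta)_x=c_1X^0_\alpha,\quad \xi_x=b_1X^0_\alpha,$$ $$\phi_y=-a_2X^0_\beta,\quad (X^0_\alpha)_y=c_2X^0_\beta,\quad (X^0_\beta)_y=a_2\phi-c_2X^0_\alpha-b_2\xi,\quad \xi_y=b_2X^0_\beta .$$ A curvature surface determined by $F^0$ is a map $f^0:D\to\mathbb R^4$ with $df^0=h^{-1}\bigl(\tfrac{x^2-y^2}{x}X^0_\alpha\,dx+2yX^0_\beta\,dy\bigr)$. Put $B_2=-\tfrac12\tfrac{X_0'}x-\sqrt5$, $C_2=X_0''-\tfrac{X_0'}x$, $$u=\frac{yX^0_\beta-\phi}{\sqrt{1+y^2}},\qquad \tilde u=\frac{-B_2X^0_\alpha+C_2\xi}{\sqrt{B_2^2+C_2^2}},\qquad \mathbf f=\frac{X^0_\beta-2(1+y^2)\xi+y\phi}{\sqrt{(1+y^2)(5+4y^2)}},$$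 $$T(x)=\frac{(X_0'+2\sqrt5\,x)(2X_0+\sqrt5)}{4xX_0'\,(2X_0-xX_0'-X_0'/x+\sqrt5)},\qquad \tilde w(x)=\tfrac{\sqrt5}2\log x+\int_0^x\Bigl(T(t)-\tfrac{\sqrt5}{2t}\Bigr)dt,$$ $$v_2^0(y)=\frac{(5+4y^2)\frac{5+\sqrt5}2-\sqrt5y^2}{\sqrt{5+4y^2}\,h(0,y)},\qquad v_3^0(y)=-\frac{2\sqrt5\,y^2}{h(0,y)}\sqrt{\frac{1+y^2}{5+4y^2}},\qquad r(y)=\frac1{2\sqrt5}\sqrt{\frac{5+4y^2}{1+y^2}} .$$ "$p(t)$ converges uniformly to $q(t)$ as $t\to\infty$" means: for every $\varepsilon>0$ there is $U$ with $\|p(t)-q(t)\|<\varepsilon$ for all $t>U$; the convergence is uniform in $y$ if $U$ can be chosen independently of $y\in\mathbb R$. **Theorem.** For every such $F^0$ the vector $u$ depends only on $y$ and $\tilde u$ depends only on $x$, and there is an orthonormal frame $[b^\infty,c^\infty,\tilde b^\infty,\tilde c^\infty]$ of $\mathbb R^4$ of constant vectors such that the following holds. 1. $u(y)$ moves on the unit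 circle of $\mathrm{span}(\tilde b^\infty,\tilde c^\infty)$. There is a continuous $v_1(y)$ with $\frac{du}{dy}=\frac{y^2}{1+y^2}v_1(y)$, and $[u(y),v_1(y),b^\infty,c^\infty]$ is orthonormal for every $y\in\mathbb R$. For all $y\in\mathbb R$ $$u(y)=-\sin(y-\arctan y)\,\tilde b^\infty+\cos(y-\arctan y)\,\tilde c^\infty,\quad v_1(y)=-\cos(y-\arctan y)\,\tilde b^\infty-\sin(y-\arctan y)\,\tilde c^\infty,$$ and $(\tilde b^\infty,\tilde c^\infty)$ is the only pair completing $b^\infty,c^\infty$ to an orthonormal frame for which these two formulas hold. As $y\to\infty$, $u(y)$ and $v_1(y)$ converge uniformly to $\cos y\,\tilde b^\infty+\sin y\,\tilde c^\infty$ and $-\sin y\,\tilde b^\infty+\cos y\,\tilde c^\infty$. 2. $\tilde u(x)$ moves on the unit circle of $\mathrm{span}(b^\infty,c^\infty)$. For $x>0$ one has $T(x)>0$, and there is a unit vector $\tilde v_1(x)$ with $\frac{d\tilde u}{dx}=T\tilde v_1$, $\frac{d\tilde v_1}{dx}=-T\tilde u$; thus $\frac{d}{ds}\tilde u(e^{-s})=-e^{-s}T(e^{-s})\,\tilde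 v_1(e^{-s})$. The integral defining $\tilde w$ converges and $$\tilde u(x)=\cos\tilde w(x)\,b^\infty+\sin\tilde w(x)\,c^\infty,\qquad \tilde v_1(x)=-\sin\tilde w(x)\,b^\infty+\cos\tilde w(x)\,c^\infty .$$ As $s\to\infty$, $\tilde u(e^{-s})$ and $\tilde v_1(e^{-s})$ converge uniformly to $b(s)=\cos\frac{\sqrt5s}2b^\infty-\sin\frac{\sqrt5s}2c^\infty$ and $-v_2(s)=\sin\frac{\sqrt5s}2b^\infty+\cos\frac{\sqrt5s}2c^\infty$. 3. As $s\to\infty$, $X^0_\alpha(e^{-s},y)$ converges uniformly to $b(s)$ and $\mathbf f(e^{-s},y)$ converges uniformly to the circle $a(s,y)=\frac2{\sqrt5}\bigl(-v_2^0(y)v_1(y)+v_3^0(y)v_2(s)\bigr)$, both uniformly in $y\in\mathbb R$. The map $a(s,y)$ is continuous, and $a(s,0)=-v_1(0)$ is a single point. 4. For every curvature surface $f^0$ determined by $F^0$ there is a continuous $A:\mathbb R\to\mathbb R^4$ with $f^0(x,y)=r(y)\,\mathbf f(x,y)+A(y)$ on $D$. As $s\to\infty$, $f^0(e^{-s},y)$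 converges uniformly, and uniformly in $y\in\mathbb R$, to the circle $\Gamma(s,y)=r(y)\,a(s,y)+A(y)$, which depends continuously on $(s,y)$ and degenerates for $y=0$ to the point $-\frac12v_1(0)+A(0)$. -/

import Mathlib

namespace CurvSurf

noncomputable section

/-- Euclidean four-space. -/
abbrev E4 : Type := EuclideanSpace ℝ (Fin 4)

/-- The coefficients of `X₀`: `a 0 = 5/2`, and
`2 (k+1) (4 k² + 5/4) a (k+1) + (2 k - 1) a k = 0` for all `k ≥ 0`
(for `k = 0` this says `a 1 = 1`). -/
def a : ℕ → ℝ
  | 0 => 5 / 2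
  | k + 1 => -((2 * (k : ℝ) - 1) * a k) / (2 * ((k : ℝ) + 1) * (4 * (k : ℝ) ^ 2 + 5 / 4))

theorem a_one : a 1 = 1 := by
  norm_num [a]

theorem a_rec (k : ℕ) :
    2 * ((k : ℝ) + 1) * (4 * (k : ℝ) ^ 2 + 5 / 4) * a (k + 1) + (2 * (k : ℝ) - 1) * a k = 0 := by
  have h : 2 * ((k : ℝ) + 1) * (4 * (k : ℝ) ^ 2 + 5 / 4) ≠ 0 := by positivity
  rw [a, mul_div_cancel₀ _ h]
  ring

/-- The hypergeometric function `X₀(x) = 5/2 + x² - x⁴/21 + ⋯`. -/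
def X0 (x : ℝ) : ℝ := ∑' k : ℕ, a k * x ^ (2 * k)

/-- `X₀'`. -/
def X0' (x : ℝ) : ℝ := deriv X0 x

/-- `X₀''`. -/
def X0'' (x : ℝ) : ℝ := deriv (deriv X0) x

/-- `X₀'(x) / x`, continued by its limit `2` at `x = 0`. -/
def X0q (x : ℝ) : ℝ := if x = 0 then 2 else X0' x / x

/-- `h(x,y) = 2 X₀ - x X₀' + y² X₀'/x + √5`. -/
def h (x y : ℝ) : ℝ := 2 * X0 x - x * X0' x + y ^ 2 * X0q x + √5

/-! ### The structure equation -/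

def a₁ (x y : ℝ) : ℝ := 2 * y / (x * h x y) * (X0 x + √5 / 2)

def b₁ (x y : ℝ) : ℝ := -1 / (x * h x y) * (X0 x + √5 / 2 + √5 * (x ^ 2 - y ^ 2))

def c₁ (x y : ℝ) : ℝ := -2 / (x * h x y) * (X0 x + √5 / 2)

def a₂ (x y : ℝ) : ℝ := -1 / h x y * (2 * X0 x + √5 - (x ^ 2 + y ^ 2) * X0q x)

def b₂ (x y : ℝ) : ℝ := -2 * y / h x y * (X0q x / 2 + √5)

def c₂ (x y : ℝ) : ℝ := 2 * y / h x y * (X0'' x - X0q x)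

/-- The `dx`-part of the connection form `Ω = Ω₁ dx + Ω₂ dy`. -/
def Ω₁ (x y : ℝ) : Matrix (Fin 4) (Fin 4) ℝ :=
  !![0, a₁ x y, 0, 0;
     -a₁ x y, 0, c₁ x y, b₁ x y;
     0, -c₁ x y, 0, 0;
     0, -b₁ x y, 0, 0]

/-- The `dy`-part of the connection form `Ω = Ω₁ dx + Ω₂ dy`. -/
def Ω₂ (x y : ℝ) : Matrix (Fin 4) (Fin 4) ℝ :=
  !![0, 0, a₂ x y, 0;
     0, 0, -c₂ x y, 0;
     -a₂ x y, c₂ x y, 0, b₂ x y;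
     0, 0, -b₂ x y, 0]

/-- `F x y = [φ, X_α, X_β, ξ](x, y)` (in this order, indices `0, 1, 2, 3`) is an orthonormal frame
field of `ℝ⁴` on `D = {x > 0}` that solves the structure equation `dF = F Ω`: the vectors
`F x y i` are the columns of the matrix `F`, so that `∂ₓ F_j = ∑ᵢ (Ω₁)ᵢⱼ Fᵢ` and
`∂_y F_j = ∑ᵢ (Ω₂)ᵢⱼ Fᵢ`. -/
structure IsFrameField (F : ℝ → ℝ → Fin 4 → E4) : Prop where
  orthonormal : ∀ x y : ℝ, 0 < x → Orthonormal ℝ (F x y)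
  deriv_x : ∀ (x y : ℝ) (j : Fin 4), 0 < x →
    HasDerivAt (fun s => F s y j) (∑ i, Ω₁ x y i j • F x y i) x
  deriv_y : ∀ (x y : ℝ) (j : Fin 4), 0 < x →
    HasDerivAt (fun t => F x t j) (∑ i, Ω₂ x y i j • F x y i) y

/-- `f` is a curvature surface on `D = {x > 0}` determined by the frame field `F`:
`df = h⁻¹ (((x² - y²)/x) X_α dx + 2 y X_β dy)`. -/
structure IsCurvatureSurface (F : ℝ → ℝ → Fin 4 → E4) (f : ℝ → ℝ → E4) : Prop where
  deriv_x : ∀ x y : ℝ, 0 < x →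
    HasDerivAt (fun s => f s y) (((x ^ 2 - y ^ 2) / (x * h x y)) • F x y 1) x
  deriv_y : ∀ x y : ℝ, 0 < x →
    HasDerivAt (fun t => f x t) ((2 * y / h x y) • F x y 2) y

/-! ### The vectors attached to the frame field -/

def B₂ (x : ℝ) : ℝ := -(1 / 2) * X0q x - √5

def C₂ (x : ℝ) : ℝ := X0'' x - X0q x

/-- `(1 + y²)^{-1/2} (y X_β - φ)(x, y)`. -/
def uField (F : ℝ → ℝ → Fin 4 → E4) (x y : ℝ) : E4 :=
  (1 / √(1 + y ^ 2)) • (y • F x y 2 - F x y 0)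

/-- `(B₂² + C₂²)^{-1/2} (-B₂ X_α + C₂ ξ)(x, y)`. -/
def uTildeField (F : ℝ → ℝ → Fin 4 → E4) (x y : ℝ) : E4 :=
  (1 / √(B₂ x ^ 2 + C₂ x ^ 2)) • (-B₂ x • F x y 1 + C₂ x • F x y 3)

/-- `((1 + y²)(5 + 4y²))^{-1/2} (X_β - 2 (1 + y²) ξ + y φ)(x, y)`. -/
def fField (F : ℝ → ℝ → Fin 4 → E4) (x y : ℝ) : E4 :=
  (1 / √((1 + y ^ 2) * (5 + 4 * y ^ 2))) •
    (F x y 2 - (2 * (1 + y ^ 2)) • F x y 3 + y • F x y 0)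

/-- The radius `(2√5)⁻¹ √((5 + 4y²)/(1 + y²))` of the sphere that carries an `x`-curve. -/
def radius (y : ℝ) : ℝ := 1 / (2 * √5) * √((5 + 4 * y ^ 2) / (1 + y ^ 2))

/-- The angular speed of `ũ`. -/
def T (x : ℝ) : ℝ :=
  (X0' x + 2 * √5 * x) * (2 * X0 x + √5) /
    (4 * x * X0' x * (2 * X0 x - x * X0' x - X0q x + √5))

/-- `T(x) - (√5/2)(1/x)`. -/
def Treg (x : ℝ) : ℝ := T x - √5 / 2 * (1 / x)

/-- The angle `w̃(x) = (√5/2) log x + ∫₀ˣ (T - √5/(2t)) dt`. -/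
def wTilde (x : ℝ) : ℝ := √5 / 2 * Real.log x + ∫ t in (0 : ℝ)..x, Treg t

/-! ### The limit circles -/

def v₂ (x y : ℝ) : ℝ :=
  1 / (√(5 + 4 * y ^ 2) * h x y) *
    ((5 + 4 * y ^ 2) * (X0 x + √5 / 2) + √5 * (x ^ 2 - y ^ 2))

def v₃ (x y : ℝ) : ℝ :=
  2 * √5 * (x ^ 2 - y ^ 2) / h x y * √((1 + y ^ 2) / (5 + 4 * y ^ 2))

/-- `cos(√5 s/2) b - sin(√5 s/2) c`. -/
def bCircle (b c : E4) (s : ℝ) : E4 :=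
  Real.cos (√5 * s / 2) • b - Real.sin (√5 * s / 2) • c

/-- `-sin(√5 s/2) b - cos(√5 s/2) c`. -/
def v2Circle (b c : E4) (s : ℝ) : E4 :=
  -(Real.sin (√5 * s / 2) • b) - Real.cos (√5 * s / 2) • c

/-- `(2/√5) (-v₂(0,y) v(y) + v₃(0,y) (-sin(√5 s/2) b - cos(√5 s/2) c))`. -/
def aCircle (b c : E4) (v : ℝ → E4) (s y : ℝ) : E4 :=
  (2 / √5) • (-v₂ 0 y • v y + v₃ 0 y • v2Circle b c s)

/-- `cos y b + sin y c`. -/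
def bTildeCircle (b c : E4) (y : ℝ) : E4 := Real.cos y • b + Real.sin y • c

/-- `-sin y b + cos y c`. -/
def cTildeCircle (b c : E4) (y : ℝ) : E4 := -(Real.sin y • b) + Real.cos y • c

/-- `-sin(y - arctan y) b + cos(y - arctan y) c`. -/
def uCurve (b c : E4) (y : ℝ) : E4 :=
  -(Real.sin (y - Real.arctan y) • b) + Real.cos (y - Real.arctan y) • c

/-- `-cos(y - arctan y) b - sin(y - arctan y) c`. -/
def vCurve (b c : E4) (y : ℝ) : E4 :=
  -(Real.cos (y - Real.arctan y) • b) - Real.sin (y - Real.arctan y) • c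

/-! ### Uniform convergence -/

/-- `p(t)` converges uniformly to `q(t)` as `t → ∞`. -/
def ConvergesTo (p q : ℝ → E4) : Prop :=
  ∀ ε : ℝ, 0 < ε → ∃ U : ℝ, ∀ t : ℝ, U < t → ‖p t - q t‖ < ε

/-- `p(t, y)` converges uniformly to `q(t, y)` as `t → ∞`, and uniformly with respect to `y`. -/
def ConvergesToUnif (p q : ℝ → ℝ → E4) : Prop :=
  ∀ ε : ℝ, 0 < ε → ∃ U : ℝ, ∀ t : ℝ, U < t → ∀ y : ℝ, ‖p t y - q t y‖ < ε

end

end CurvSurf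

open CurvSurf

namespace CurvSurf

open Filter Topology Real

open scoped RealInnerProductSpace

noncomputable section

/-! ### Entire power series on the real line -/

/-! The structure equation decouples. The vector `u` has zero `x`-derivative because `a₁ = -y c₁`,
and `ũ` has zero `y`-derivative because `(b₂, c₂)` is proportional to `(B₂, C₂)`. Differentiating
each in its own variable gives `u_y = y²/(1+y²) v` and `ũ_x = T ṽ` with explicit `v`, `ṽ`, and `u,
v, ũ, ṽ` form an orthonormal basis. So `u, v` depend on `y` only and `ũ, ṽ` on `x` only. An
orthonormal pair whose complement is fixed can only rotate in its own plane
(`hasDerivAt_of_orthonormal`); integrating the speeds gives the angles `y - arctan y` and `w̃`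
(`rotation_const`).

The algebra rests on the first integral `(X₀'/x) K = B₂² + C₂²` of the differential equation of `X₀`
(`X0q_mul_K`). It yields `X₀'/x > 0`, `K > 0`, hence `h > 0` and `T > 0`. It also yields `h² = E² +
4(1+y²)(B₂²+C₂²)`, which makes `v` and `ṽ` unit vectors.

For the limits, `x T(x)` is differentiable with value `√5/2` at `0`, so `w̃(e^{-s}) + √5 s/2` tends
to `0`; for `u` and `v` it suffices that `arctan y` tends to `π/2`. The field `f` has no
`u`-component (`fField_eq`). Its coefficients along `v, ṽ, ũ` converge uniformly in `y` because `h =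
K + (1+y²) X₀'/x` grows like `1+y²` (`inv_h_sub_le`). Finally `r f` has the same `x`-derivative as
any curvature surface, so the two differ by a function `A(y)`. -/

/-- The sum of the power series with coefficients `c`. -/
def powSum (c : ℕ → ℝ) (z : ℝ) : ℝ := ∑' k, c k * z ^ k

/-- The power series with coefficients `c` has infinite radius of convergence. -/
def IsEntireSeq (c : ℕ → ℝ) : Prop := ∀ r : ℝ, 0 ≤ r → Summable fun k => |c k| * r ^ k

theorem IsEntireSeq.summable {c : ℕ → ℝ} (hc : IsEntireSeq c) (z : ℝ) :
    Summable fun k => c k * z ^ k := by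
  refine Summable.of_norm ?_
  simpa [abs_mul, abs_pow] using hc |z| (abs_nonneg z)

theorem IsEntireSeq.derivCoeff {c : ℕ → ℝ} (hc : IsEntireSeq c) :
    IsEntireSeq fun k => ((k : ℝ) + 1) * c (k + 1) := by
  intro r hr
  -- The radius `2 (r + 1)` leaves room for the factor `k + 1 ≤ 2 ^ (k + 1)` and for the index shift
  -- `r ^ k ≤ (r + 1) ^ (k + 1)`.
  have h := (summable_nat_add_iff 1).2 (hc (2 * (r + 1)) (by positivity))
  refine Summable.of_nonneg_of_le (fun k => by positivity) (fun k => ?_) h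
  have h1 : ((k : ℝ) + 1) ≤ 2 ^ (k + 1) := by
    exact_mod_cast (Nat.lt_two_pow_self (n := k + 1)).le
  have h2 : r ^ k ≤ (r + 1) ^ (k + 1) :=
    (pow_le_pow_left₀ hr (by linarith) k).trans
      (pow_le_pow_right₀ (by linarith) (Nat.le_succ k))
  rw [abs_mul, abs_of_pos (by positivity : (0 : ℝ) < (k : ℝ) + 1), mul_pow]
  have h3 := mul_le_mul h1 h2 (by positivity) (by positivity)
  nlinarith [abs_nonneg (c (k + 1))]

theorem IsEntireSeq.mulIndex {c : ℕ → ℝ} (hc : IsEntireSeq c) :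
    IsEntireSeq fun k => (k : ℝ) * c k := by
  intro r hr
  refine (summable_nat_add_iff 1).1 ?_
  refine ((hc.derivCoeff r hr).mul_right r).congr fun k => ?_
  push_cast
  ring

theorem IsEntireSeq.const_mul {c : ℕ → ℝ} (hc : IsEntireSeq c) (t : ℝ) :
    IsEntireSeq fun k => t * c k := by
  intro r hr
  refine ((hc r hr).mul_left |t|).congr fun k => ?_
  rw [abs_mul]
  ring

theorem IsEntireSeq.hasDerivAt {c : ℕ → ℝ} (hc : IsEntireSeq c) (z : ℝ) :
    HasDerivAt (powSum c) (powSum (fun k => ((k : ℝ) + 1) * c (k + 1)) z) z := by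
  set R : ℝ := |z| + 1
  have hR : 0 ≤ R := by positivity
  have hu : Summable fun k : ℕ => (k : ℝ) * |c k| * R ^ (k - 1) := by
    refine (summable_nat_add_iff 1).1 ?_
    refine (hc.derivCoeff R hR).congr fun k => ?_
    rw [abs_mul, abs_of_pos (by positivity : (0 : ℝ) < (k : ℝ) + 1)]
    simp
  have hz : z ∈ Metric.ball (0 : ℝ) R := by simp [R]
  have hd := hasDerivAt_tsum_of_isPreconnected (g := fun k z => c k * z ^ k)
    (g' := fun k z => c k * ((k : ℝ) * z ^ (k - 1))) hu Metric.isOpen_ball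
    (convex_ball (0 : ℝ) R).isPreconnected
    (fun k y _ => (hasDerivAt_pow k y).const_mul (c k)) (fun k y hy => ?_)
    (y₀ := z) hz (hc.summable z) hz
  · refine hd.congr_deriv ?_
    have hs : Summable fun k : ℕ => c k * ((k : ℝ) * z ^ (k - 1)) := by
      refine (summable_nat_add_iff 1).1 ((hc.derivCoeff.summable z).congr fun k => ?_)
      simp; ring
    rw [hs.tsum_eq_zero_add]
    simp only [powSum, CharP.cast_eq_zero, zero_mul, mul_zero, zero_add]
    refine tsum_congr fun k => ?_
    simp; ring
  · have : |y| ≤ R := by simpa using (Metric.mem_ball.1 hy).le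
    rw [Real.norm_eq_abs, abs_mul, abs_mul, abs_pow, Nat.abs_cast]
    have h2 := pow_le_pow_left₀ (abs_nonneg y) this (k - 1)
    have h3 := mul_le_mul_of_nonneg_left h2 (by positivity : 0 ≤ (k : ℝ) * |c k|)
    linarith

/-- The Euler operator `z d/dz` multiplies the `k`-th coefficient by `k`; this turns the recurrence
for `a` into a differential equation. -/
theorem IsEntireSeq.mul_powSum_deriv {c : ℕ → ℝ} (hc : IsEntireSeq c) (z : ℝ) :
    z * powSum (fun k => ((k : ℝ) + 1) * c (k + 1)) z = powSum (fun k => (k : ℝ) * c k) z := by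
  rw [powSum, powSum, (hc.mulIndex.summable z).tsum_eq_zero_add, ← tsum_mul_left]
  simp only [CharP.cast_eq_zero, zero_mul, zero_add]
  refine tsum_congr fun k => ?_
  push_cast
  ring

theorem powSum_zero (c : ℕ → ℝ) : powSum c 0 = c 0 := by
  rw [powSum, tsum_eq_single 0 (fun k hk => by simp [hk])]
  simp

/-! ### The function `X₀` -/

/-- Each step of the recurrence shrinks the coefficient by at least `1 / (k + 1)`, so the
exponential series is a majorant and `X₀` is entire. -/
theorem abs_a_le (k : ℕ) : |a k| ≤ 5 / 2 / (k.factorial : ℝ) := by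
  induction k with
  | zero => norm_num [a, abs_of_pos]
  | succ k ih =>
    have hpos : (0 : ℝ) < 2 * ((k : ℝ) + 1) * (4 * (k : ℝ) ^ 2 + 5 / 4) := by positivity
    have h1 : |2 * (k : ℝ) - 1| ≤ 2 * (4 * (k : ℝ) ^ 2 + 5 / 4) := by
      rw [abs_le]
      constructor <;> nlinarith [sq_nonneg ((k : ℝ) - 1), (Nat.cast_nonneg k : (0 : ℝ) ≤ k)]
    rw [a, abs_div, abs_neg, abs_mul, abs_of_pos hpos, div_le_iff₀ hpos, Nat.factorial_succ]
    push_cast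
    have hf : (0 : ℝ) < (k.factorial : ℝ) := by positivity
    calc |2 * (k : ℝ) - 1| * |a k|
        ≤ (2 * (4 * (k : ℝ) ^ 2 + 5 / 4)) * (5 / 2 / (k.factorial : ℝ)) :=
          mul_le_mul h1 ih (abs_nonneg _) (by positivity)
      _ = _ := by field_simp

theorem isEntireSeq_a : IsEntireSeq a := by
  intro r hr
  refine Summable.of_nonneg_of_le (fun k => by positivity) (fun k => ?_)
    ((Real.summable_pow_div_factorial r).mul_left (5 / 2))
  have := mul_le_mul_of_nonneg_right (abs_a_le k) (pow_nonneg hr k)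
  calc _ ≤ _ := this
    _ = _ := by ring

/-- The coefficients of `X₀'/x` as a series in `x²`. -/
def qCoeff (k : ℕ) : ℝ := 2 * (((k : ℝ) + 1) * a (k + 1))

theorem isEntireSeq_qCoeff : IsEntireSeq qCoeff := isEntireSeq_a.derivCoeff.const_mul 2

/-- The coefficients of `X₀'' - X₀'/x` as a series in `x²`. -/
def cCoeff (k : ℕ) : ℝ := 2 * ((k : ℝ) * qCoeff k)

theorem isEntireSeq_cCoeff : IsEntireSeq cCoeff := isEntireSeq_qCoeff.mulIndex.const_mul 2

theorem powSum_const_mul (t : ℝ) (c : ℕ → ℝ) (z : ℝ) :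
    powSum (fun k => t * c k) z = t * powSum c z := by
  simp only [powSum, mul_assoc, tsum_mul_left]

theorem IsEntireSeq.hasDerivAt_sq {c : ℕ → ℝ} (hc : IsEntireSeq c) (x : ℝ) :
    HasDerivAt (fun x => powSum c (x ^ 2))
      (x * powSum (fun k => 2 * (((k : ℝ) + 1) * c (k + 1))) (x ^ 2)) x := by
  have h := (hc.hasDerivAt (x ^ 2)).comp x (hasDerivAt_pow 2 x)
  refine h.congr_deriv ?_
  rw [powSum_const_mul 2]
  push_cast
  ring

theorem IsEntireSeq.euler_sq {c : ℕ → ℝ} (hc : IsEntireSeq c) (x : ℝ) :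
    x * (x * powSum (fun k => 2 * (((k : ℝ) + 1) * c (k + 1))) (x ^ 2)) =
      powSum (fun k => 2 * ((k : ℝ) * c k)) (x ^ 2) := by
  rw [powSum_const_mul 2, powSum_const_mul 2, ← hc.mul_powSum_deriv]
  ring

theorem X0_eq (x : ℝ) : X0 x = powSum a (x ^ 2) := by
  simp only [X0, powSum, pow_mul]

theorem hasDerivAt_X0' (x : ℝ) : HasDerivAt X0 (x * powSum qCoeff (x ^ 2)) x := by
  rw [show X0 = fun x => powSum a (x ^ 2) from funext X0_eq]
  exact isEntireSeq_a.hasDerivAt_sq x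

theorem X0q_eq (x : ℝ) : X0q x = powSum qCoeff (x ^ 2) := by
  unfold X0q
  split_ifs with hx
  -- The value `2` assigned at `0` is the constant coefficient `qCoeff 0 = 2 * a 1`.
  · subst hx
    rw [zero_pow two_ne_zero, powSum_zero]
    norm_num [qCoeff, a_one]
  · rw [X0', (hasDerivAt_X0' x).deriv]
    field_simp

theorem X0'_eq (x : ℝ) : X0' x = x * X0q x := by
  rw [X0', (hasDerivAt_X0' x).deriv, X0q_eq]

theorem hasDerivAt_X0 (x : ℝ) : HasDerivAt X0 (x * X0q x) x := by
  rw [X0q_eq]; exact hasDerivAt_X0' x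

theorem hasDerivAt_X0q_aux (x : ℝ) : HasDerivAt X0q
    (x * powSum (fun k => 2 * (((k : ℝ) + 1) * qCoeff (k + 1))) (x ^ 2)) x := by
  rw [show X0q = fun x => powSum qCoeff (x ^ 2) from funext X0q_eq]
  exact isEntireSeq_qCoeff.hasDerivAt_sq x

theorem C₂_eq (x : ℝ) : C₂ x = powSum cCoeff (x ^ 2) := by
  have h1 : deriv X0 = fun x => x * X0q x := funext fun x => (hasDerivAt_X0 x).deriv
  have h2 := ((hasDerivAt_id x).mul (hasDerivAt_X0q_aux x)).deriv
  rw [C₂, X0'', h1]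
  have h3 : deriv (fun x => x * X0q x) x = _ := h2
  rw [h3, show cCoeff = fun k : ℕ => 2 * ((k : ℝ) * qCoeff k) from rfl, ← isEntireSeq_qCoeff.euler_sq]
  simp

/-- The derivative is described through `x * d`, not a quotient, so that `x = 0` is included; the
first integral is differentiated on the whole line. -/
theorem exists_hasDerivAt_X0q (x : ℝ) : ∃ d, HasDerivAt X0q d x ∧ x * d = C₂ x :=
  ⟨_, hasDerivAt_X0q_aux x, by rw [C₂_eq]; exact isEntireSeq_qCoeff.euler_sq x⟩

/-- The differential equation of `X₀`: the left side is `x C₂'`, and comparing coefficients of `x ^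
(2 * k)` gives exactly `a_rec k`. -/
theorem X0_ode (x : ℝ) : powSum (fun k => 2 * ((k : ℝ) * cCoeff k)) (x ^ 2) =
    X0 x - (5 / 4 + x ^ 2) * X0q x := by
  set z := x ^ 2
  have h1 := (isEntireSeq_cCoeff.mulIndex.const_mul 2).summable z
  have h2 := isEntireSeq_qCoeff.summable z
  have h3 := isEntireSeq_a.summable z
  have h4 : z * powSum qCoeff z = powSum (fun k => 2 * ((k : ℝ) * a k)) z := by
    have : qCoeff = fun k : ℕ => 2 * (((k : ℝ) + 1) * a (k + 1)) := rfl
    rw [this, powSum_const_mul 2, powSum_const_mul 2, ← isEntireSeq_a.mul_powSum_deriv]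
    ring
  have h5 := (isEntireSeq_a.mulIndex.const_mul 2).summable z
  rw [X0_eq, X0q_eq, add_mul, h4]
  have h6 : powSum (fun k => 2 * ((k : ℝ) * cCoeff k)) z + 5 / 4 * powSum qCoeff z +
      powSum (fun k => 2 * ((k : ℝ) * a k)) z - powSum a z = 0 := by
    simp only [powSum]
    rw [← tsum_mul_left, ← h1.tsum_add (h2.mul_left _),
      ← (h1.add (h2.mul_left _)).tsum_add h5, ← ((h1.add (h2.mul_left _)).add h5).tsum_sub h3]
    rw [← tsum_zero (α := ℝ) (β := ℕ)]
    refine tsum_congr fun k => ?_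
    rw [cCoeff, qCoeff]
    linear_combination (a_rec k) * z ^ k
  linarith

theorem exists_hasDerivAt_C₂ (x : ℝ) :
    ∃ d, HasDerivAt C₂ d x ∧ x * d = X0 x - (5 / 4 + x ^ 2) * X0q x := by
  refine ⟨x * powSum (fun k => 2 * (((k : ℝ) + 1) * cCoeff (k + 1))) (x ^ 2), ?_, ?_⟩
  · rw [show C₂ = fun x => powSum cCoeff (x ^ 2) from funext C₂_eq]
    exact isEntireSeq_cCoeff.hasDerivAt_sq x
  · rw [isEntireSeq_cCoeff.euler_sq, X0_ode]

theorem hasDerivAt_X0q {x : ℝ} (hx : x ≠ 0) : HasDerivAt X0q (C₂ x / x) x := by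
  obtain ⟨d, hd, h⟩ := exists_hasDerivAt_X0q x
  rwa [← h, mul_div_cancel_left₀ _ hx]

theorem hasDerivAt_C₂ {x : ℝ} (hx : x ≠ 0) :
    HasDerivAt C₂ ((X0 x - (5 / 4 + x ^ 2) * X0q x) / x) x := by
  obtain ⟨d, hd, h⟩ := exists_hasDerivAt_C₂ x
  rwa [← h, mul_div_cancel_left₀ _ hx]

theorem hasDerivAt_B₂ {x : ℝ} (hx : x ≠ 0) : HasDerivAt B₂ (-(1 / 2) * (C₂ x / x)) x :=
  ((hasDerivAt_X0q hx).const_mul _).sub_const _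

theorem differentiable_X0 : Differentiable ℝ X0 := fun x => (hasDerivAt_X0 x).differentiableAt

theorem differentiable_X0q : Differentiable ℝ X0q := fun x =>
  (exists_hasDerivAt_X0q x).choose_spec.1.differentiableAt

theorem differentiable_C₂ : Differentiable ℝ C₂ := fun x =>
  (exists_hasDerivAt_C₂ x).choose_spec.1.differentiableAt

theorem differentiable_B₂ : Differentiable ℝ B₂ := (differentiable_X0q.const_mul _).sub_const _

theorem X0_zero : X0 0 = 5 / 2 := by
  rw [X0_eq, zero_pow two_ne_zero, powSum_zero, a]

theorem X0q_zero : X0q 0 = 2 := by simp [X0q]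

theorem C₂_zero : C₂ 0 = 0 := by
  rw [C₂_eq, zero_pow two_ne_zero, powSum_zero]
  simp [cCoeff]

theorem B₂_zero : B₂ 0 = -(1 + √5) := by
  rw [B₂, X0q_zero]; ring

/-! ### The first integral -/

/-- `2 X₀ - x X₀' - X₀'/x + √5`. -/
def K (x : ℝ) : ℝ := 2 * X0 x - x ^ 2 * X0q x - X0q x + √5

theorem differentiable_K : Differentiable ℝ K := by
  unfold K
  have := differentiable_X0
  have := differentiable_X0q
  fun_prop

theorem K_zero : K 0 = 3 + √5 := by
  rw [K, X0_zero, X0q_zero]; ring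

/-- The difference of the two sides has zero derivative by the equations for `X₀'/x` and `C₂`. It
vanishes at `0`, where it reads `2 (3 + √5) = (1 + √5)²`. -/
theorem X0q_mul_K (x : ℝ) : X0q x * K x = B₂ x ^ 2 + C₂ x ^ 2 := by
  have key : ∀ x, HasDerivAt (fun x => X0q x * K x - (B₂ x ^ 2 + C₂ x ^ 2)) 0 x := by
    intro x
    obtain ⟨d, hd, h1⟩ := exists_hasDerivAt_X0q x
    obtain ⟨e, he, h2⟩ := exists_hasDerivAt_C₂ x
    have hK : HasDerivAt K (2 * (x * X0q x) - (2 * x * X0q x + x ^ 2 * d) - d) x := by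
      have := (((((hasDerivAt_X0 x).const_mul 2).sub ((hasDerivAt_pow 2 x).mul hd)).sub hd).add_const
        (√5))
      refine this.congr_deriv ?_
      simp
    have hB : HasDerivAt B₂ (-(1 / 2) * d) x := (hd.const_mul _).sub_const _
    refine ((hd.mul hK).sub ((hB.pow 2).add (he.pow 2))).congr_deriv ?_
    have h3 : C₂ x * e = d * (X0 x - (5 / 4 + x ^ 2) * X0q x) := by rw [← h1, ← h2]; ring
    have : B₂ x = -(1 / 2) * X0q x - √5 := rfl
    simp only [K, this, Nat.cast_ofNat, Nat.add_one_sub_one, pow_one]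
    linear_combination -2 * h3
  have hc := is_const_of_deriv_eq_zero (fun x => (key x).differentiableAt)
    (fun x => (key x).deriv) x 0
  have h5 : √5 ^ 2 = 5 := Real.sq_sqrt (by norm_num)
  rw [K_zero, B₂_zero, C₂_zero, X0q_zero] at hc
  linear_combination hc - h5

/-- At a zero of `X₀'/x` one has `B₂ = -√5`, and the first integral would read `0 = 5 + C₂²`. Since
the value at `0` is `2`, the intermediate value theorem excludes a change of sign. -/
theorem X0q_pos (x : ℝ) : 0 < X0q x := by
  by_contra! hx
  obtain ⟨z, hz⟩ := mem_range_of_exists_le_of_exists_ge differentiable_X0q.continuous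
    ⟨x, hx⟩ ⟨0, by rw [X0q_zero]; norm_num⟩
  have h := X0q_mul_K z
  have h5 : √5 ^ 2 = 5 := Real.sq_sqrt (by norm_num)
  simp only [B₂, hz] at h
  nlinarith [sq_nonneg (C₂ z)]

theorem B₂_neg (x : ℝ) : B₂ x < 0 := by
  have := X0q_pos x
  have : 0 < √5 := by positivity
  unfold B₂
  linarith

theorem K_pos (x : ℝ) : 0 < K x := by
  have h := X0q_mul_K x
  have h1 := B₂_neg x
  have : 0 < X0q x * K x := by rw [h]; nlinarith [sq_nonneg (C₂ x)]
  exact pos_of_mul_pos_right this (X0q_pos x).le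

theorem h_eq (x y : ℝ) : h x y = K x + (1 + y ^ 2) * X0q x := by
  rw [h, K, X0'_eq]; ring

theorem h_pos (x y : ℝ) : 0 < h x y := by
  rw [h_eq]
  have := K_pos x
  have := X0q_pos x
  positivity

theorem two_X0_eq (x : ℝ) : 2 * X0 x + √5 = K x + (1 + x ^ 2) * X0q x := by
  rw [K]; ring

theorem two_X0_pos (x : ℝ) : 0 < 2 * X0 x + √5 := by
  rw [two_X0_eq]
  have := K_pos x
  have := X0q_pos x
  positivity

/-! ### The angle `w̃` -/

/-- `x T(x)`, continued to `x = 0`. -/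
def xT (x : ℝ) : ℝ := (X0q x + 2 * √5) * (2 * X0 x + √5) / (4 * X0q x * K x)

theorem T_eq {x : ℝ} (hx : x ≠ 0) : T x = xT x / x := by
  have h1 := (X0q_pos x).ne'
  have h2 := (K_pos x).ne'
  have h3 : 2 * X0 x - x * X0' x - X0q x + √5 = K x := by rw [K, X0'_eq]; ring
  rw [T, h3, X0'_eq, xT]
  field_simp

theorem T_pos {x : ℝ} (hx : 0 < x) : 0 < T x := by
  rw [T_eq hx.ne', xT]
  have := X0q_pos x
  have := K_pos x
  have := two_X0_pos x
  positivity

theorem xT_zero : xT 0 = √5 / 2 := by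
  have h5 : √5 ^ 2 = 5 := Real.sq_sqrt (by norm_num)
  have h0 : 0 < √5 := by positivity
  rw [xT, X0_zero, X0q_zero, K_zero]
  field_simp
  linear_combination -2 * h5

theorem differentiable_xT : Differentiable ℝ xT := by
  unfold xT
  have := differentiable_X0
  have := differentiable_X0q
  have := differentiable_K
  have hne : ∀ x, 4 * X0q x * K x ≠ 0 := fun x => by
    have := X0q_pos x
    have := K_pos x
    positivity
  fun_prop (disch := exact hne _)

/-- The difference quotient of `x T(x)` at `0` is the continuous extension of `T - √5/(2x)`; hence
the integral in `w̃` converges. -/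
theorem continuous_dslope_xT : Continuous (dslope xT 0) := by
  refine continuous_iff_continuousAt.2 fun x => ?_
  rcases eq_or_ne x 0 with rfl | hx
  · exact continuousAt_dslope_same.2 differentiable_xT.differentiableAt
  · exact (continuousAt_dslope_of_ne hx).2 differentiable_xT.continuous.continuousAt

theorem Treg_eq {x : ℝ} (hx : x ≠ 0) : Treg x = dslope xT 0 x := by
  rw [dslope_of_ne _ hx, slope_def_field, xT_zero, Treg, T_eq hx]
  field_simp
  ring

theorem intervalIntegrable_Treg {x : ℝ} (hx : 0 < x) :
    IntervalIntegrable Treg MeasureTheory.volume 0 x := by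
  refine (continuous_dslope_xT.intervalIntegrable 0 x).congr ?_
  intro t ht
  rw [Set.uIoc_of_le hx.le] at ht
  exact (Treg_eq ht.1.ne').symm

theorem integral_Treg {x : ℝ} (hx : 0 < x) :
    ∫ t in (0 : ℝ)..x, Treg t = ∫ t in (0 : ℝ)..x, dslope xT 0 t := by
  -- At `t = 0` division by zero gives `Treg` a meaningless value, but the interval of integration
  -- is half-open and omits it.
  refine intervalIntegral.integral_congr_ae (MeasureTheory.ae_of_all _ fun t ht => ?_)
  rw [Set.uIoc_of_le hx.le] at ht
  exact Treg_eq ht.1.ne'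

theorem wTilde_eq {x : ℝ} (hx : 0 < x) :
    wTilde x = √5 / 2 * Real.log x + ∫ t in (0 : ℝ)..x, dslope xT 0 t := by
  rw [wTilde, integral_Treg hx]

theorem hasDerivAt_wTilde {x : ℝ} (hx : 0 < x) : HasDerivAt wTilde (T x) x := by
  have h1 : HasDerivAt (fun x => √5 / 2 * Real.log x + ∫ t in (0 : ℝ)..x, dslope xT 0 t)
      (√5 / 2 * x⁻¹ + dslope xT 0 x) x :=
    ((Real.hasDerivAt_log hx.ne').const_mul _).add
      (continuous_dslope_xT.integral_hasStrictDerivAt 0 x).hasDerivAt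
  have h2 : √5 / 2 * x⁻¹ + dslope xT 0 x = T x := by
    rw [← Treg_eq hx.ne', Treg]; ring
  rw [h2] at h1
  refine h1.congr_of_eventuallyEq ?_
  filter_upwards [lt_mem_nhds hx] with t ht using wTilde_eq ht

theorem tendsto_exp_neg : Tendsto (fun s : ℝ => Real.exp (-s)) atTop (𝓝 0) :=
  Real.tendsto_exp_atBot.comp tendsto_neg_atTop_atBot

theorem tendsto_wTilde :
    Tendsto (fun s => wTilde (Real.exp (-s)) + √5 * s / 2) atTop (𝓝 0) := by
  have h1 : Tendsto (fun x => ∫ t in (0 : ℝ)..x, dslope xT 0 t) (𝓝 0) (𝓝 0) := by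
    have := (continuous_dslope_xT.integral_hasStrictDerivAt 0 0).hasDerivAt.continuousAt.tendsto
    simpa using this
  refine (h1.comp tendsto_exp_neg).congr fun s => ?_
  rw [wTilde_eq (Real.exp_pos _), Real.log_exp, Function.comp]
  ring

/-! ### Linear algebra in `ℝ⁴` -/

/-- The vector with coordinates `p, q, r, s` in the frame `G`. -/
def comb (G : Fin 4 → E4) (p q r s : ℝ) : E4 := p • G 0 + q • G 1 + r • G 2 + s • G 3

theorem inner_comb {G : Fin 4 → E4} (hG : Orthonormal ℝ G) (p q r s p' q' r' s' : ℝ) :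
    ⟪comb G p q r s, comb G p' q' r' s'⟫ = p * p' + q * q' + r * r' + s * s' := by
  have hG' := orthonormal_iff_ite.1 hG
  simp only [comb, inner_add_left, inner_add_right, real_inner_smul_left, real_inner_smul_right,
    hG']
  simp
  ring

theorem orthonormal_vec4 {p q r s : E4} : Orthonormal ℝ ![p, q, r, s] ↔
    ⟪p, p⟫ = 1 ∧ ⟪q, q⟫ = 1 ∧ ⟪r, r⟫ = 1 ∧ ⟪s, s⟫ = 1 ∧ ⟪p, q⟫ = 0 ∧ ⟪p, r⟫ = 0 ∧ ⟪p, s⟫ = 0 ∧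
      ⟪q, r⟫ = 0 ∧ ⟪q, s⟫ = 0 ∧ ⟪r, s⟫ = 0 := by
  rw [orthonormal_iff_ite]
  constructor
  · intro H
    exact ⟨H 0 0, H 1 1, H 2 2, H 3 3, H 0 1, H 0 2, H 0 3, H 1 2, H 1 3, H 2 3⟩
  · rintro ⟨h1, h2, h3, h4, h5, h6, h7, h8, h9, h10⟩ i j
    have k5 := (real_inner_comm p q).trans h5
    have k6 := (real_inner_comm p r).trans h6
    have k7 := (real_inner_comm p s).trans h7
    have k8 := (real_inner_comm q r).trans h8
    have k9 := (real_inner_comm q s).trans h9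
    have k10 := (real_inner_comm r s).trans h10
    fin_cases i <;> fin_cases j <;> assumption

theorem eq_zero_of_inner_eq_zero {G : Fin 4 → E4} (hG : Orthonormal ℝ G) {z : E4}
    (hz : ∀ i, ⟪G i, z⟫ = 0) : z = 0 := by
  have hs : Submodule.span ℝ (Set.range G) = ⊤ :=
    hG.linearIndependent.span_eq_top_of_card_eq_finrank (by simp)
  rw [← (OrthonormalBasis.mk hG hs.ge).sum_repr' z]
  simp [hz]

theorem orthonormal_rotate {p q r s : E4} (H : Orthonormal ℝ ![p, q, r, s]) (t : ℝ) :
    Orthonormal ℝ ![cos t • p - sin t • q, sin t • p + cos t • q, r, s] := by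
  rw [orthonormal_vec4] at H ⊢
  obtain ⟨h1, h2, h3, h4, h5, h6, h7, h8, h9, h10⟩ := H
  have h5' : ⟪q, p⟫ = 0 := by rw [real_inner_comm]; exact h5
  have := sin_sq_add_cos_sq t
  simp only [inner_add_left, inner_add_right, inner_sub_left, inner_sub_right,
    real_inner_smul_left, real_inner_smul_right, h1, h2, h3, h4, h5, h6, h7, h8, h9, h10, h5']
  refine ⟨?_, ?_, ?_, ?_, ?_, ?_, ?_, ?_, ?_, ?_⟩ <;> first | trivial | linarith

theorem orthonormal_swap {p q r s : E4} (H : Orthonormal ℝ ![p, q, r, s]) :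
    Orthonormal ℝ ![r, s, p, q] := by
  rw [orthonormal_vec4] at H ⊢
  obtain ⟨h1, h2, h3, h4, h5, h6, h7, h8, h9, h10⟩ := H
  refine ⟨h3, h4, h1, h2, h10, ?_, ?_, ?_, ?_, h5⟩ <;> (rw [real_inner_comm]; assumption)

/-- Differentiating the constant products `⟪v, v⟫`, `⟪u, v⟫`, `⟪v, e₁⟫`, `⟪v, e₂⟫` determines all
four components of `v'`. Only differentiability of `v` is needed, so no second differentiation of
the explicit formulas is required. -/
theorem hasDerivAt_of_orthonormal {S : Set ℝ} (hS : IsOpen S) {u v : ℝ → E4} {k : ℝ → ℝ}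
    {e₁ e₂ : E4} (hu : ∀ t ∈ S, HasDerivAt u (k t • v t) t)
    (hv : ∀ t ∈ S, DifferentiableAt ℝ v t)
    (ho : ∀ t ∈ S, Orthonormal ℝ ![u t, v t, e₁, e₂]) {t : ℝ} (ht : t ∈ S) :
    HasDerivAt v (-k t • u t) t := by
  have hd := (hv t ht).hasDerivAt
  set w := deriv v t
  have hev : ∀ᶠ s in 𝓝 t, s ∈ S := hS.mem_nhds ht
  obtain ⟨h1, h2, -, -, h5, h6, h7, h8, h9, -⟩ := orthonormal_vec4.1 (ho t ht)
  have zero_of : ∀ {g : ℝ → ℝ} {g' c : ℝ}, HasDerivAt g g' t → (∀ s ∈ S, g s = c) → g' = 0 :=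
    fun hg hc => hg.unique ((hasDerivAt_const t _).congr_of_eventuallyEq (hev.mono hc))
  have k1 := zero_of (hd.inner ℝ hd) fun s hs => (orthonormal_vec4.1 (ho s hs)).2.1
  have k2 := zero_of ((hu t ht).inner ℝ hd) fun s hs => (orthonormal_vec4.1 (ho s hs)).2.2.2.2.1
  have k3 := zero_of (hd.inner ℝ (hasDerivAt_const t e₁))
    fun s hs => (orthonormal_vec4.1 (ho s hs)).2.2.2.2.2.2.2.1
  have k4 := zero_of (hd.inner ℝ (hasDerivAt_const t e₂))
    fun s hs => (orthonormal_vec4.1 (ho s hs)).2.2.2.2.2.2.2.2.1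
  have hw : w - -k t • u t = 0 := by
    refine eq_zero_of_inner_eq_zero (ho t ht) fun i => ?_
    have h5' : ⟪v t, u t⟫ = 0 := by rw [real_inner_comm]; exact h5
    rw [real_inner_smul_left, h2] at k2
    rw [inner_zero_right, zero_add] at k3 k4
    rw [real_inner_comm] at k3 k4 h6 h7
    rw [inner_sub_right, real_inner_smul_right]
    fin_cases i
    · change ⟪u t, w⟫ - -k t * ⟪u t, u t⟫ = 0
      rw [h1]; linarith
    · change ⟪v t, w⟫ - -k t * ⟪v t, u t⟫ = 0
      rw [h5']; linarith [real_inner_comm w (v t)]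
    · change ⟪e₁, w⟫ - -k t * ⟪e₁, u t⟫ = 0
      rw [k3, h6]; ring
    · change ⟪e₂, w⟫ - -k t * ⟪e₂, u t⟫ = 0
      rw [k4, h7]; ring
  rwa [sub_eq_zero.1 hw] at hd

/-- Rotating the pair back by the angle `θ` gives two vectors with zero derivative. Their values at
`t₀` are the constant vectors in the formulas. -/
theorem rotation_const {S : Set ℝ} (hS : IsOpen S) (hS' : IsPreconnected S) {u v : ℝ → E4}
    {k θ : ℝ → ℝ} (hu : ∀ t ∈ S, HasDerivAt u (k t • v t) t)
    (hv : ∀ t ∈ S, HasDerivAt v (-k t • u t) t) (hθ : ∀ t ∈ S, HasDerivAt θ (k t) t)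
    {t₀ t : ℝ} (ht₀ : t₀ ∈ S) (ht : t ∈ S) :
    u t = cos (θ t) • (cos (θ t₀) • u t₀ - sin (θ t₀) • v t₀) +
        sin (θ t) • (sin (θ t₀) • u t₀ + cos (θ t₀) • v t₀) ∧
      v t = -(sin (θ t) • (cos (θ t₀) • u t₀ - sin (θ t₀) • v t₀)) +
        cos (θ t) • (sin (θ t₀) • u t₀ + cos (θ t₀) • v t₀) := by
  have hconst : ∀ {g : ℝ → E4}, (∀ t ∈ S, HasDerivAt g 0 t) → g t = g t₀ := fun hg =>
    hS.is_const_of_deriv_eq_zero hS' (fun s hs => (hg s hs).differentiableAt.differentiableWithinAt)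
      (fun s hs => (hg s hs).deriv) ht ht₀
  have h1 := hconst (g := fun t => cos (θ t) • u t - sin (θ t) • v t) fun s hs =>
    (((hθ s hs).cos.smul (hu s hs)).sub ((hθ s hs).sin.smul (hv s hs))).congr_deriv (by module)
  have h2 := hconst (g := fun t => sin (θ t) • u t + cos (θ t) • v t) fun s hs =>
    (((hθ s hs).sin.smul (hu s hs)).add ((hθ s hs).cos.smul (hv s hs))).congr_deriv (by module)
  rw [← h1, ← h2]
  have h3 := sin_sq_add_cos_sq (θ t)
  constructor
  · match_scalars <;> first | linear_combination -h3 | linear_combination h3 | ring1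
  · match_scalars <;> first | linear_combination -h3 | linear_combination h3 | ring1

/-! ### The moving frame -/

/-- `(1 + y²) X₀'/x - (2 X₀ - x X₀' - X₀'/x + √5)`. -/
def E (x y : ℝ) : ℝ := (1 + y ^ 2) * X0q x - K x

/-- The unit velocity direction of `u`. -/
def vField (F : ℝ → ℝ → Fin 4 → E4) (x y : ℝ) : E4 :=
  comb (F x y) (1 / √(1 + y ^ 2) * (E x y * y / h x y))
    (1 / √(1 + y ^ 2) * (-2 * (1 + y ^ 2) * C₂ x / h x y)) (1 / √(1 + y ^ 2) * (E x y / h x y))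
    (1 / √(1 + y ^ 2) * (-2 * (1 + y ^ 2) * B₂ x / h x y))

/-- The unit velocity direction of `ũ`. -/
def vTildeField (F : ℝ → ℝ → Fin 4 → E4) (x y : ℝ) : E4 :=
  comb (F x y) (1 / √(B₂ x ^ 2 + C₂ x ^ 2) * (2 * (B₂ x ^ 2 + C₂ x ^ 2) * y / h x y))
    (1 / √(B₂ x ^ 2 + C₂ x ^ 2) * (E x y * C₂ x / h x y))
    (1 / √(B₂ x ^ 2 + C₂ x ^ 2) * (2 * (B₂ x ^ 2 + C₂ x ^ 2) / h x y))
    (1 / √(B₂ x ^ 2 + C₂ x ^ 2) * (E x y * B₂ x / h x y))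

theorem uField_eq (F : ℝ → ℝ → Fin 4 → E4) (x y : ℝ) : uField F x y =
    comb (F x y) (1 / √(1 + y ^ 2) * -1) 0 (1 / √(1 + y ^ 2) * y) 0 := by
  rw [uField, comb]; module

theorem uTildeField_eq (F : ℝ → ℝ → Fin 4 → E4) (x y : ℝ) : uTildeField F x y =
    comb (F x y) 0 (1 / √(B₂ x ^ 2 + C₂ x ^ 2) * -B₂ x) 0
      (1 / √(B₂ x ^ 2 + C₂ x ^ 2) * C₂ x) := by
  rw [uTildeField, comb]; module

theorem B₂_sq_add_pos (x : ℝ) : 0 < B₂ x ^ 2 + C₂ x ^ 2 := by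
  have := B₂_neg x
  nlinarith [sq_nonneg (C₂ x)]

/-- This is `(p - q)² + 4pq = (p + q)²` with `p = (1 + y²) X₀'/x` and `q = K`; the first integral
evaluates `pq`. -/
theorem h_sq (x y : ℝ) :
    E x y ^ 2 + 4 * (1 + y ^ 2) * (B₂ x ^ 2 + C₂ x ^ 2) = h x y ^ 2 := by
  rw [← X0q_mul_K, h_eq, E]; ring

theorem orthonormal_fields {F : ℝ → ℝ → Fin 4 → E4} {x y : ℝ} (ho : Orthonormal ℝ (F x y)) :
    Orthonormal ℝ ![uField F x y, vField F x y, uTildeField F x y, vTildeField F x y] := by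
  have hq : (0 : ℝ) < 1 + y ^ 2 := by positivity
  have hM := B₂_sq_add_pos x
  have hh := h_pos x y
  have hsq := h_sq x y
  have hQ : (1 / √(1 + y ^ 2)) ^ 2 = 1 / (1 + y ^ 2) := by
    rw [div_pow, sq_sqrt hq.le, one_pow]
  have hN : (1 / √(B₂ x ^ 2 + C₂ x ^ 2)) ^ 2 = 1 / (B₂ x ^ 2 + C₂ x ^ 2) := by
    rw [div_pow, sq_sqrt hM.le, one_pow]
  rw [orthonormal_vec4, uField_eq, uTildeField_eq, vField, vTildeField]
  simp only [inner_comb ho]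
  generalize 1 / √(1 + y ^ 2) = Q at *
  generalize 1 / √(B₂ x ^ 2 + C₂ x ^ 2) = N at *
  generalize h x y = k at *
  generalize E x y = e at *
  generalize B₂ x = B at *
  generalize C₂ x = C at *
  refine ⟨?_, ?_, ?_, ?_, ?_, ?_, ?_, ?_, ?_, ?_⟩
  · calc _ = Q ^ 2 * (1 + y ^ 2) := by ring
      _ = 1 := by rw [hQ]; field_simp
  · calc _ = Q ^ 2 * (1 + y ^ 2) * (e ^ 2 + 4 * (1 + y ^ 2) * (B ^ 2 + C ^ 2)) / k ^ 2 := by ring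
      _ = 1 := by rw [hQ, hsq]; field_simp
  · calc _ = N ^ 2 * (B ^ 2 + C ^ 2) := by ring
      _ = 1 := by rw [hN]; field_simp
  · calc _ = N ^ 2 * (B ^ 2 + C ^ 2) * (e ^ 2 + 4 * (1 + y ^ 2) * (B ^ 2 + C ^ 2)) / k ^ 2 := by ring
      _ = 1 := by rw [hN, hsq]; field_simp
  all_goals ring

theorem hasDerivAt_one_div_sqrt {g : ℝ → ℝ} {g' t : ℝ} (hg : HasDerivAt g g' t) (hp : 0 < g t) :
    HasDerivAt (fun s => 1 / √(g s)) (-(1 / √(g t)) * (g' / (2 * g t))) t := by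
  have h1 := (hg.sqrt hp.ne').inv (Real.sqrt_pos.2 hp).ne'
  simp only [one_div]
  refine h1.congr_deriv ?_
  rw [sq_sqrt hp.le]
  field_simp

/-! ### Derivatives of `u` and `ũ` from the structure equation. -/

namespace IsFrameField

variable {F : ℝ → ℝ → Fin 4 → E4}

theorem deriv_x_zero (hF : IsFrameField F) {x : ℝ} (hx : 0 < x) (y : ℝ) :
    HasDerivAt (fun s => F s y 0) (-a₁ x y • F x y 1) x := by
  simpa [Fin.sum_univ_four, Ω₁] using hF.deriv_x x y 0 hx

theorem deriv_x_one (hF : IsFrameField F) {x : ℝ} (hx : 0 < x) (y : ℝ) :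
    HasDerivAt (fun s => F s y 1)
      (a₁ x y • F x y 0 + -c₁ x y • F x y 2 + -b₁ x y • F x y 3) x := by
  simpa [Fin.sum_univ_four, Ω₁] using hF.deriv_x x y 1 hx

theorem deriv_x_two (hF : IsFrameField F) {x : ℝ} (hx : 0 < x) (y : ℝ) :
    HasDerivAt (fun s => F s y 2) (c₁ x y • F x y 1) x := by
  simpa [Fin.sum_univ_four, Ω₁] using hF.deriv_x x y 2 hx

theorem deriv_x_three (hF : IsFrameField F) {x : ℝ} (hx : 0 < x) (y : ℝ) :
    HasDerivAt (fun s => F s y 3) (b₁ x y • F x y 1) x := by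
  simpa [Fin.sum_univ_four, Ω₁] using hF.deriv_x x y 3 hx

theorem deriv_y_zero (hF : IsFrameField F) {x : ℝ} (hx : 0 < x) (y : ℝ) :
    HasDerivAt (fun t => F x t 0) (-a₂ x y • F x y 2) y := by
  simpa [Fin.sum_univ_four, Ω₂] using hF.deriv_y x y 0 hx

theorem deriv_y_one (hF : IsFrameField F) {x : ℝ} (hx : 0 < x) (y : ℝ) :
    HasDerivAt (fun t => F x t 1) (c₂ x y • F x y 2) y := by
  simpa [Fin.sum_univ_four, Ω₂] using hF.deriv_y x y 1 hx

theorem deriv_y_two (hF : IsFrameField F) {x : ℝ} (hx : 0 < x) (y : ℝ) :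
    HasDerivAt (fun t => F x t 2)
      (a₂ x y • F x y 0 + -c₂ x y • F x y 1 + -b₂ x y • F x y 3) y := by
  simpa [Fin.sum_univ_four, Ω₂] using hF.deriv_y x y 2 hx

theorem deriv_y_three (hF : IsFrameField F) {x : ℝ} (hx : 0 < x) (y : ℝ) :
    HasDerivAt (fun t => F x t 3) (b₂ x y • F x y 2) y := by
  simpa [Fin.sum_univ_four, Ω₂] using hF.deriv_y x y 3 hx

theorem differentiableAt_x (hF : IsFrameField F) {x : ℝ} (hx : 0 < x) (y : ℝ) (i : Fin 4) :
    DifferentiableAt ℝ (fun s => F s y i) x := (hF.deriv_x x y i hx).differentiableAt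

theorem differentiable_y (hF : IsFrameField F) {x : ℝ} (hx : 0 < x) (i : Fin 4) :
    Differentiable ℝ (fun t => F x t i) := fun y => (hF.deriv_y x y i hx).differentiableAt

theorem a₁_eq (x y : ℝ) : a₁ x y = -y * c₁ x y := by
  rw [a₁, c₁]; ring

theorem uField_deriv_x (hF : IsFrameField F) {x : ℝ} (hx : 0 < x) (y : ℝ) :
    HasDerivAt (fun s => uField F s y) 0 x := by
  refine ((((hF.deriv_x_two hx y).const_smul y).sub (hF.deriv_x_zero hx y)).const_smul
    (1 / √(1 + y ^ 2))).congr_deriv ?_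
  rw [a₁_eq]; module

/-- The left side is, up to a positive factor depending on `y`, the `X_β`-component of `u_y`; the
factor `y²` in the speed of `u` appears here. -/
theorem a₂_eq (x y : ℝ) : 1 + (1 + y ^ 2) * a₂ x y = y ^ 2 * E x y / h x y := by
  have := (h_pos x y).ne'
  rw [a₂, E]
  field_simp
  rw [h_eq, K]
  ring

theorem uField_deriv_y (hF : IsFrameField F) {x : ℝ} (hx : 0 < x) (y : ℝ) :
    HasDerivAt (fun t => uField F x t) ((y ^ 2 / (1 + y ^ 2)) • vField F x y) y := by
  have hq : (0 : ℝ) < 1 + y ^ 2 := by positivity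
  have hh := (h_pos x y).ne'
  have h1 := hasDerivAt_one_div_sqrt ((hasDerivAt_pow 2 y).const_add 1) hq
  refine (h1.smul (((hasDerivAt_id y).smul (hF.deriv_y_two hx y)).sub
    (hF.deriv_y_zero hx y))).congr_deriv ?_
  have h2 : a₂ x y = (y ^ 2 * E x y / h x y - 1) / (1 + y ^ 2) := by
    rw [← a₂_eq]; field_simp; ring
  rw [vField, comb, h2, b₂, c₂, ← C₂, show X0q x / 2 + √5 = - B₂ x by rw [B₂]; ring]
  simp only [id, Pi.smul_apply', Pi.sub_apply]
  generalize 1 / √(1 + y ^ 2) = Q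
  match_scalars <;> field_simp <;> ring

theorem uTildeField_deriv_y (hF : IsFrameField F) {x : ℝ} (hx : 0 < x) (y : ℝ) :
    HasDerivAt (fun t => uTildeField F x t) 0 y := by
  refine ((((hF.deriv_y_one hx y).const_smul (-B₂ x)).add
    ((hF.deriv_y_three hx y).const_smul (C₂ x))).const_smul
    (1 / √(B₂ x ^ 2 + C₂ x ^ 2))).congr_deriv ?_
  rw [b₂, c₂, ← C₂, show X0q x / 2 + √5 = - B₂ x by rw [B₂]; ring]
  match_scalars; ring

theorem T_eq_B₂ {x : ℝ} (hx : x ≠ 0) :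
    T x = -B₂ x * (2 * X0 x + √5) / (2 * x * (B₂ x ^ 2 + C₂ x ^ 2)) := by
  have h1 := (X0q_pos x).ne'
  have h2 := (K_pos x).ne'
  rw [T_eq hx, xT, ← X0q_mul_K, B₂]
  field_simp
  ring

/-- The left side is `b₁ (B₂² + C₂²) + B₂ C₂' - B₂' C₂`: the rotation of the frame plus that of the
direction `(B₂, C₂)`. It governs the part of `ũ_x` in the plane of `X_α` and `ξ`. -/
theorem b₁_eq {x : ℝ} (hx : x ≠ 0) (y : ℝ) :
    b₁ x y * (B₂ x ^ 2 + C₂ x ^ 2) + B₂ x * ((X0 x - (5 / 4 + x ^ 2) * X0q x) / x) -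
      -(1 / 2) * (C₂ x / x) * C₂ x = T x * (E x y * (B₂ x ^ 2 + C₂ x ^ 2)) / h x y := by
  have hM := (B₂_sq_add_pos x).ne'
  have hh := (h_pos x y).ne'
  have hpoly : -(X0 x + √5 / 2 + √5 * (x ^ 2 - y ^ 2)) * (B₂ x ^ 2 + C₂ x ^ 2) +
      h x y * (B₂ x * (X0 x - (5 / 4 + x ^ 2) * X0q x) + C₂ x ^ 2 / 2) =
      -B₂ x * (2 * X0 x + √5) * E x y / 2 := by
    have h1 := X0q_mul_K x
    have h2 : C₂ x ^ 2 = X0q x * K x - B₂ x ^ 2 := by rw [h1]; ring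
    rw [← h1, h2, h_eq, E, B₂, K]
    ring
  rw [T_eq_B₂ hx, b₁]
  field_simp
  linear_combination 8 * hpoly

theorem uTildeField_deriv_x (hF : IsFrameField F) {x : ℝ} (hx : 0 < x) (y : ℝ) :
    HasDerivAt (fun s => uTildeField F s y) (T x • vTildeField F x y) x := by
  have hM := B₂_sq_add_pos x
  have hM' := hM.ne'
  have hh := (h_pos x y).ne'
  have hB := hasDerivAt_B₂ hx.ne'
  have hC := hasDerivAt_C₂ hx.ne'
  have h1 := hasDerivAt_one_div_sqrt ((hB.pow 2).add (hC.pow 2)) hM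
  refine (h1.smul ((hB.neg.smul (hF.deriv_x_one hx y)).add
    (hC.smul (hF.deriv_x_three hx y)))).congr_deriv ?_
  have hb : b₁ x y = T x * E x y / h x y - (B₂ x * ((X0 x - (5 / 4 + x ^ 2) * X0q x) / x) -
      -(1 / 2) * (C₂ x / x) * C₂ x) / (B₂ x ^ 2 + C₂ x ^ 2) := by
    have := b₁_eq hx.ne' y
    rw [eq_sub_iff_add_eq, ← mul_left_inj' hM', add_mul, div_mul_cancel₀ _ hM']
    linear_combination this
  -- This matches the `φ`- and `X_β`-components of `ũ_x`, while `hb` handles those along `X_α` and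
  -- `ξ`.
  have hT : B₂ x * c₁ x y = T x * (2 * (B₂ x ^ 2 + C₂ x ^ 2)) / h x y := by
    rw [T_eq_B₂ hx.ne', c₁]
    field_simp
  rw [vTildeField, comb, a₁_eq, hb]
  simp only [Pi.smul_apply', Pi.neg_apply, Pi.add_apply, Pi.pow_apply, Nat.cast_ofNat, Nat.add_one_sub_one, pow_one]
  generalize 1 / √(B₂ x ^ 2 + C₂ x ^ 2) = N
  generalize C₂ x / x = d at *
  generalize (X0 x - (5 / 4 + x ^ 2) * X0q x) / x = e at *
  match_scalars
  · linear_combination N * y * hT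
  · linear_combination N * hT
  · field_simp; ring
  · field_simp; ring

/-! ### Separation of the variables. -/

theorem const_x {g : ℝ → E4} (hg : ∀ x, 0 < x → HasDerivAt g 0 x) {x : ℝ} (hx : 0 < x) :
    g x = g 1 :=
  isOpen_Ioi.is_const_of_deriv_eq_zero (s := Set.Ioi (0 : ℝ)) isPreconnected_Ioi
    (fun s hs => (hg s hs).differentiableAt.differentiableWithinAt)
    (fun s hs => (hg s hs).deriv) hx (Set.mem_Ioi.2 one_pos)

theorem uField_const (hF : IsFrameField F) {x : ℝ} (hx : 0 < x) (y : ℝ) :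
    uField F x y = uField F 1 y :=
  const_x (g := fun s => uField F s y) (fun _ hs => hF.uField_deriv_x hs y) hx

theorem uTildeField_const (hF : IsFrameField F) {x : ℝ} (hx : 0 < x) (y : ℝ) :
    uTildeField F x y = uTildeField F x 0 :=
  is_const_of_deriv_eq_zero (fun t => (hF.uTildeField_deriv_y hx t).differentiableAt)
    (fun t => (hF.uTildeField_deriv_y hx t).deriv) y 0

theorem differentiable_vField (hF : IsFrameField F) {x : ℝ} (hx : 0 < x) :
    Differentiable ℝ (vField F x) := by
  have hi := fun i => hF.differentiable_y hx i
  have hh : Differentiable ℝ (h x) := by unfold h; fun_prop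
  have hE : Differentiable ℝ (E x) := by unfold E; fun_prop
  have hne := fun y => (h_pos x y).ne'
  have hq : ∀ y : ℝ, 1 + y ^ 2 ≠ 0 := fun y => by positivity
  have hs : ∀ y : ℝ, √(1 + y ^ 2) ≠ 0 := fun y => by positivity
  unfold vField comb
  fun_prop (disch := first | exact hne _ | exact hq _ | exact hs _)

theorem differentiableAt_vTildeField (hF : IsFrameField F) {x : ℝ} (hx : 0 < x) (y : ℝ) :
    DifferentiableAt ℝ (fun s => vTildeField F s y) x := by
  have hi := fun i => hF.differentiableAt_x hx y i
  have := differentiable_X0q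
  have := differentiable_K
  have := differentiable_B₂
  have := differentiable_C₂
  have hh : Differentiable ℝ (fun s => h s y) := by simp only [h_eq]; fun_prop
  have hE : Differentiable ℝ (fun s => E s y) := by unfold E; fun_prop
  have hne := fun x => (h_pos x y).ne'
  have hM := fun x => (B₂_sq_add_pos x).ne'
  have hs := fun x => (sqrt_pos.2 (B₂_sq_add_pos x)).ne'
  unfold vTildeField comb
  fun_prop (disch := first | exact hne _ | exact hM _ | exact hs _)

/-- Since `u` does not depend on `x`, neither does `u_y = y²/(1+y²) v`. The factor can be cancelled
only for `y ≠ 0`; continuity and density cover `y = 0`. -/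
theorem vField_const (hF : IsFrameField F) {x : ℝ} (hx : 0 < x) (y : ℝ) :
    vField F x y = vField F 1 y := by
  have hne : ∀ y : ℝ, y ≠ 0 → vField F x y = vField F 1 y := by
    intro y hy
    have h1 := (hF.uField_deriv_y hx y).unique
      ((hF.uField_deriv_y one_pos y).congr_of_eventuallyEq
        (Eventually.of_forall fun t => hF.uField_const hx t))
    exact smul_right_injective _ (by positivity) h1
  have hclosed : IsClosed {y | vField F x y = vField F 1 y} :=
    isClosed_eq (hF.differentiable_vField hx).continuous
      (hF.differentiable_vField one_pos).continuous
  have hsub : ({0}ᶜ : Set ℝ) ⊆ {y | vField F x y = vField F 1 y} := fun y hy => hne y hy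
  have := hclosed.closure_subset_iff.2 hsub
  rw [(dense_compl_singleton (0 : ℝ)).closure_eq] at this
  exact this (Set.mem_univ y)

theorem vTildeField_const (hF : IsFrameField F) {x : ℝ} (hx : 0 < x) (y : ℝ) :
    vTildeField F x y = vTildeField F x 0 := by
  have h1 := (hF.uTildeField_deriv_x hx y).unique
    ((hF.uTildeField_deriv_x hx 0).congr_of_eventuallyEq ((lt_mem_nhds hx).mono
      fun t ht => hF.uTildeField_const ht y))
  exact smul_right_injective _ (T_pos hx).ne' h1

theorem orthonormal_const (hF : IsFrameField F) {x : ℝ} (hx : 0 < x) (y : ℝ) :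
    Orthonormal ℝ ![uField F 1 y, vField F 1 y, uTildeField F x 0, vTildeField F x 0] := by
  have := orthonormal_fields (hF.orthonormal x y hx)
  rwa [hF.uField_const hx, hF.vField_const hx, hF.uTildeField_const hx,
    hF.vTildeField_const hx] at this

theorem vField_deriv_y (hF : IsFrameField F) (y : ℝ) :
    HasDerivAt (vField F 1) (-(y ^ 2 / (1 + y ^ 2)) • uField F 1 y) y :=
  hasDerivAt_of_orthonormal (k := fun y => y ^ 2 / (1 + y ^ 2)) isOpen_univ
    (fun t _ => hF.uField_deriv_y one_pos t) (fun t _ => hF.differentiable_vField one_pos t)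
    (fun t _ => hF.orthonormal_const one_pos t) (Set.mem_univ y)

theorem vTildeField_deriv_x (hF : IsFrameField F) {x : ℝ} (hx : 0 < x) :
    HasDerivAt (fun s => vTildeField F s 0) (-T x • uTildeField F x 0) x :=
  hasDerivAt_of_orthonormal (S := Set.Ioi 0) (u := fun s => uTildeField F s 0) isOpen_Ioi
    (fun _ ht => hF.uTildeField_deriv_x ht 0) (fun _ ht => hF.differentiableAt_vTildeField ht 0)
    (fun _ ht => orthonormal_swap (hF.orthonormal_const ht 0)) hx

end IsFrameField

/-! ### Uniform convergence -/

theorem convergesTo_of_le {p q : ℝ → E4} {g : ℝ → ℝ} (hg : Tendsto g atTop (𝓝 0))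
    (hpq : ∀ t, ‖p t - q t‖ ≤ g t) : ConvergesTo p q := by
  intro ε hε
  obtain ⟨U, hU⟩ := eventually_atTop.1 (hg.eventually_lt_const hε)
  exact ⟨U, fun t ht => (hpq t).trans_lt (hU t ht.le)⟩

theorem convergesToUnif_of_le {p q : ℝ → ℝ → E4} {g : ℝ → ℝ} (hg : Tendsto g atTop (𝓝 0))
    (hpq : ∀ t y, ‖p t y - q t y‖ ≤ g t) : ConvergesToUnif p q := by
  intro ε hε
  obtain ⟨U, hU⟩ := eventually_atTop.1 (hg.eventually_lt_const hε)
  exact ⟨U, fun t ht y => (hpq t y).trans_lt (hU t ht.le)⟩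

theorem norm_circle_sub_le {b c : E4} (hb : ‖b‖ = 1) (hc : ‖c‖ = 1) (s t : ℝ) :
    ‖(cos s • b + sin s • c) - (cos t • b + sin t • c)‖ ≤ 2 * |s - t| := by
  have h1 : |cos s - cos t| ≤ |s - t| := by
    simpa [Real.dist_eq] using Real.lipschitzWith_cos.dist_le_mul s t
  have h2 : |sin s - sin t| ≤ |s - t| := by
    simpa [Real.dist_eq] using Real.lipschitzWith_sin.dist_le_mul s t
  calc _ = ‖(cos s - cos t) • b + (sin s - sin t) • c‖ := by congr 1; module
    _ ≤ |cos s - cos t| + |sin s - sin t| := by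
      refine (norm_add_le _ _).trans_eq ?_
      rw [norm_smul, norm_smul, hb, hc, mul_one, mul_one, norm_eq_abs, norm_eq_abs]
    _ ≤ _ := by linarith

/-! ### The unit vector field attached to the `x`-curves -/

/-- There is no `u`-component: the `φ` and `X_β` parts of `f` are proportional to `yφ + X_β`,
orthogonal to `yX_β - φ`. The vectors on the right depend on one variable each, so only scalar
limits remain. -/
theorem fField_eq (F : ℝ → ℝ → Fin 4 → E4) (x y : ℝ) : fField F x y =
    ((E x y + 4 * (1 + y ^ 2) * B₂ x) / (h x y * √(5 + 4 * y ^ 2))) • vField F x y +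
    (2 * √(1 + y ^ 2) * (B₂ x ^ 2 + C₂ x ^ 2 - B₂ x * E x y) /
      (√(B₂ x ^ 2 + C₂ x ^ 2) * h x y * √(5 + 4 * y ^ 2))) • vTildeField F x y +
    (-2 * √(1 + y ^ 2) * C₂ x / (√(B₂ x ^ 2 + C₂ x ^ 2) * √(5 + 4 * y ^ 2))) •
      uTildeField F x y := by
  have hq : (0 : ℝ) < 1 + y ^ 2 := by positivity
  have hM := B₂_sq_add_pos x
  have hsq := h_sq x y
  have hQ := sq_sqrt hq.le
  have hN := sq_sqrt hM.le
  have hQ0 := (sqrt_pos.2 hq).ne'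
  have hN0 := (sqrt_pos.2 hM).ne'
  have hR0 : √(5 + 4 * y ^ 2) ≠ 0 := by positivity
  have hh := (h_pos x y).ne'
  rw [fField, uTildeField_eq, vField, vTildeField, Real.sqrt_mul hq.le]
  simp only [comb]
  rw [hN.symm] at hsq
  generalize √(B₂ x ^ 2 + C₂ x ^ 2) = N at *
  generalize √(1 + y ^ 2) = Q at *
  generalize √(5 + 4 * y ^ 2) = R at *
  generalize h x y = k at *
  generalize E x y = e at *
  generalize B₂ x = B at *
  generalize C₂ x = C at *
  have hC : C ^ 2 = N ^ 2 - B ^ 2 := by rw [hN]; ring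
  rw [← hQ] at hsq ⊢
  rw [← hN]
  have he : e ^ 2 = k ^ 2 - 4 * Q ^ 2 * N ^ 2 := by rw [← hsq]; ring
  match_scalars
  · field_simp
    linear_combination -N * he
  · field_simp
    linear_combination B ^ 2 * he + k ^ 2 * hC
  · field_simp
    linear_combination -y * N * he
  · field_simp
    linear_combination 2 * C * Q * B * he

/-- The numerator `h 0 y - h x y` is of order `1 + y²` and the product of the two denominators at
least of order `(1 + y²)²`. One factor `1 + y²` is thus to spare, which the coefficient of `v` uses
up. -/
theorem inv_h_sub_le (x y : ℝ) : (1 + y ^ 2) * |1 / h x y - 1 / h 0 y| ≤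
    (|K x - K 0| + |X0q x - X0q 0|) / (2 * X0q x) := by
  have hq : (1 : ℝ) ≤ 1 + y ^ 2 := by nlinarith [sq_nonneg y]
  have hp := X0q_pos x
  have h1 : (1 + y ^ 2) * X0q x ≤ h x y := by rw [h_eq]; linarith [K_pos x]
  have h2 : (1 + y ^ 2) * 2 ≤ h 0 y := by rw [h_eq, X0q_zero]; linarith [K_pos 0]
  have h3 := h_pos x y
  have h4 := h_pos 0 y
  have h5 : |h 0 y - h x y| ≤ (1 + y ^ 2) * (|K x - K 0| + |X0q x - X0q 0|) := by
    have : h 0 y - h x y = -(K x - K 0) - (1 + y ^ 2) * (X0q x - X0q 0) := by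
      rw [h_eq, h_eq]; ring
    rw [this]
    refine (abs_sub _ _).trans ?_
    rw [abs_neg, abs_mul, abs_of_pos (by linarith : (0 : ℝ) < 1 + y ^ 2)]
    nlinarith [abs_nonneg (K x - K 0)]
  rw [div_sub_div _ _ h3.ne' h4.ne', abs_div, abs_of_pos (mul_pos h3 h4), one_mul, mul_one,
    ← mul_div_assoc, div_le_div_iff₀ (mul_pos h3 h4) (by positivity)]
  set D := |K x - K 0| + |X0q x - X0q 0|
  have hD : 0 ≤ D := by positivity
  calc (1 + y ^ 2) * |h 0 y - h x y| * (2 * X0q x)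
      ≤ (1 + y ^ 2) * ((1 + y ^ 2) * D) * (2 * X0q x) := by gcongr
    _ = D * (((1 + y ^ 2) * X0q x) * ((1 + y ^ 2) * 2)) := by ring
    _ ≤ D * (h x y * h 0 y) := by gcongr

/-- The coefficient of `v` in `fField`, without its dependence on the frame. -/
theorem coeff_v_eq (x y : ℝ) : (E x y + 4 * (1 + y ^ 2) * B₂ x) / (h x y * √(5 + 4 * y ^ 2)) =
    -1 / √(5 + 4 * y ^ 2) - 4 * √5 * (1 + y ^ 2) * (1 / h x y) / √(5 + 4 * y ^ 2) := by
  have := (h_pos x y).ne'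
  have : √(5 + 4 * y ^ 2) ≠ 0 := by positivity
  field_simp
  rw [h_eq, E, B₂]
  ring

theorem coeff_v_zero (y : ℝ) : (E 0 y + 4 * (1 + y ^ 2) * B₂ 0) / (h 0 y * √(5 + 4 * y ^ 2)) =
    -(2 / √5 * v₂ 0 y) := by
  have := (h_pos 0 y).ne'
  have : √(5 + 4 * y ^ 2) ≠ 0 := by positivity
  have h5 : √5 ^ 2 = 5 := sq_sqrt (by norm_num)
  rw [v₂, E, B₂_zero, X0q_zero, K_zero, X0_zero]
  field_simp
  linear_combination (-4 * y ^ 2 - 5) * h5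

/-- Substituting `E = h - 2K` confines `y` to the bounded root quotient and to `1 / h x y`; both are
controlled uniformly in `y`. -/
theorem coeff_vTilde_eq (x y : ℝ) :
    2 * √(1 + y ^ 2) * (B₂ x ^ 2 + C₂ x ^ 2 - B₂ x * E x y) /
      (√(B₂ x ^ 2 + C₂ x ^ 2) * h x y * √(5 + 4 * y ^ 2)) =
    2 * (√(1 + y ^ 2) / √(5 + 4 * y ^ 2)) *
      ((√(B₂ x ^ 2 + C₂ x ^ 2) + 2 * (B₂ x / √(B₂ x ^ 2 + C₂ x ^ 2)) * K x) * (1 / h x y) -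
        B₂ x / √(B₂ x ^ 2 + C₂ x ^ 2)) := by
  have hN := sq_sqrt (B₂_sq_add_pos x).le
  have hN0 := (sqrt_pos.2 (B₂_sq_add_pos x)).ne'
  have := (h_pos x y).ne'
  have : √(5 + 4 * y ^ 2) ≠ 0 := by positivity
  have hE : E x y = h x y - 2 * K x := by rw [E, h_eq]; ring
  rw [hE]
  generalize √(B₂ x ^ 2 + C₂ x ^ 2) = N at *
  rw [← hN]
  field_simp
  ring

theorem sqrt_zero_eq : √(B₂ 0 ^ 2 + C₂ 0 ^ 2) = 1 + √5 := by
  rw [B₂_zero, C₂_zero, show (-(1 + √5)) ^ 2 + (0 : ℝ) ^ 2 = (1 + √5) ^ 2 by ring]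
  exact sqrt_sq (by positivity)

theorem coeff_vTilde_zero (y : ℝ) :
    2 * √(1 + y ^ 2) * (B₂ 0 ^ 2 + C₂ 0 ^ 2 - B₂ 0 * E 0 y) /
      (√(B₂ 0 ^ 2 + C₂ 0 ^ 2) * h 0 y * √(5 + 4 * y ^ 2)) = -(2 / √5 * v₃ 0 y) := by
  have := (h_pos 0 y).ne'
  have : √(5 + 4 * y ^ 2) ≠ 0 := by positivity
  have h1 : 1 + √5 ≠ 0 := by positivity
  rw [sqrt_zero_eq, v₃, E, B₂_zero, C₂_zero, X0q_zero, K_zero, Real.sqrt_div (by positivity)]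
  field_simp
  ring

theorem sqrt_quot_le (y : ℝ) : √(1 + y ^ 2) / √(5 + 4 * y ^ 2) ≤ 1 :=
  div_le_one_of_le₀ (sqrt_le_sqrt (by nlinarith [sq_nonneg y])) (sqrt_nonneg _)

/-- This coefficient multiplies the error between `ṽ` and its limit circle, so a bound free of `y`
is needed. -/
theorem coeff_vTilde_zero_le (y : ℝ) : |2 / √5 * v₃ 0 y| ≤ 2 := by
  have h0 := h_pos 0 y
  have h2 : y ^ 2 * 2 ≤ h 0 y := by rw [h_eq, X0q_zero]; linarith [K_pos 0]
  have h3 : 2 / √5 * v₃ 0 y =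
      -(2 * (y ^ 2 * 2 / h 0 y) * (√(1 + y ^ 2) / √(5 + 4 * y ^ 2))) := by
    rw [v₃, Real.sqrt_div (by positivity)]
    field_simp
    ring
  rw [h3, abs_neg, abs_of_nonneg (by positivity)]
  have h4 : y ^ 2 * 2 / h 0 y ≤ 1 := (div_le_one h0).2 h2
  have h5 := sqrt_quot_le y
  have h6 : 0 ≤ √(1 + y ^ 2) / √(5 + 4 * y ^ 2) := by positivity
  have h7 := mul_le_one₀ h4 h6 h5
  linarith

/-- A bound for the distance of the coefficients of `fField F x y` from their values at `x = 0`. -/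
def errorBound (x : ℝ) : ℝ :=
  4 * √5 * ((|K x - K 0| + |X0q x - X0q 0|) / (2 * X0q x)) +
  2 * (|√(B₂ x ^ 2 + C₂ x ^ 2) + 2 * (B₂ x / √(B₂ x ^ 2 + C₂ x ^ 2)) * K x| *
      ((|K x - K 0| + |X0q x - X0q 0|) / (2 * X0q x)) +
    |(√(B₂ x ^ 2 + C₂ x ^ 2) + 2 * (B₂ x / √(B₂ x ^ 2 + C₂ x ^ 2)) * K x) -
      (√(B₂ 0 ^ 2 + C₂ 0 ^ 2) + 2 * (B₂ 0 / √(B₂ 0 ^ 2 + C₂ 0 ^ 2)) * K 0)| +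
    |B₂ x / √(B₂ x ^ 2 + C₂ x ^ 2) - B₂ 0 / √(B₂ 0 ^ 2 + C₂ 0 ^ 2)|) +
  2 * |C₂ x / √(B₂ x ^ 2 + C₂ x ^ 2)|

theorem continuous_errorBound : Continuous errorBound := by
  have := differentiable_K.continuous
  have := differentiable_X0q.continuous
  have := differentiable_B₂.continuous
  have := differentiable_C₂.continuous
  have h1 := fun x => (sqrt_pos.2 (B₂_sq_add_pos x)).ne'
  have h2 : ∀ x, 2 * X0q x ≠ 0 := fun x => (mul_pos two_pos (X0q_pos x)).ne'
  unfold errorBound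
  fun_prop (disch := first | exact h1 _ | exact h2 _)

theorem errorBound_zero : errorBound 0 = 0 := by
  simp [errorBound, C₂_zero]

theorem coeff_v_sub_le (x y : ℝ) :
    |(E x y + 4 * (1 + y ^ 2) * B₂ x) / (h x y * √(5 + 4 * y ^ 2)) - -(2 / √5 * v₂ 0 y)| ≤
      4 * √5 * ((|K x - K 0| + |X0q x - X0q 0|) / (2 * X0q x)) := by
  rw [← coeff_v_zero, coeff_v_eq, coeff_v_eq]
  have hR : 1 ≤ √(5 + 4 * y ^ 2) := one_le_sqrt.2 (by nlinarith [sq_nonneg y])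
  have h1 := inv_h_sub_le x y
  have hq : (0 : ℝ) < 1 + y ^ 2 := by positivity
  calc _ = |-(4 * √5 * ((1 + y ^ 2) * (1 / h x y - 1 / h 0 y)) / √(5 + 4 * y ^ 2))| := by
        congr 1; ring
    _ = 4 * √5 * ((1 + y ^ 2) * |1 / h x y - 1 / h 0 y|) / √(5 + 4 * y ^ 2) := by
      rw [abs_neg, abs_div, abs_mul, abs_mul (1 + y ^ 2), abs_of_pos hq,
        abs_of_pos (by linarith : 0 < √(5 + 4 * y ^ 2)), abs_of_pos (by positivity : 0 < 4 * √5)]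
    _ ≤ 4 * √5 * ((1 + y ^ 2) * |1 / h x y - 1 / h 0 y|) := div_le_self (by positivity) hR
    _ ≤ _ := by gcongr

theorem coeff_vTilde_sub_le (x y : ℝ) :
    |2 * √(1 + y ^ 2) * (B₂ x ^ 2 + C₂ x ^ 2 - B₂ x * E x y) /
      (√(B₂ x ^ 2 + C₂ x ^ 2) * h x y * √(5 + 4 * y ^ 2)) - -(2 / √5 * v₃ 0 y)| ≤
    2 * (|√(B₂ x ^ 2 + C₂ x ^ 2) + 2 * (B₂ x / √(B₂ x ^ 2 + C₂ x ^ 2)) * K x| *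
      ((|K x - K 0| + |X0q x - X0q 0|) / (2 * X0q x)) +
    |(√(B₂ x ^ 2 + C₂ x ^ 2) + 2 * (B₂ x / √(B₂ x ^ 2 + C₂ x ^ 2)) * K x) -
      (√(B₂ 0 ^ 2 + C₂ 0 ^ 2) + 2 * (B₂ 0 / √(B₂ 0 ^ 2 + C₂ 0 ^ 2)) * K 0)| +
    |B₂ x / √(B₂ x ^ 2 + C₂ x ^ 2) - B₂ 0 / √(B₂ 0 ^ 2 + C₂ 0 ^ 2)|) := by
  rw [← coeff_vTilde_zero, coeff_vTilde_eq, coeff_vTilde_eq]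
  have h1 := inv_h_sub_le x y
  have hq : (1 : ℝ) ≤ 1 + y ^ 2 := by nlinarith [sq_nonneg y]
  have h2 : |1 / h x y - 1 / h 0 y| ≤ (|K x - K 0| + |X0q x - X0q 0|) / (2 * X0q x) :=
    (le_mul_of_one_le_left (abs_nonneg _) hq).trans h1
  have h3 : |1 / h 0 y| ≤ 1 := by
    have h4 := h_pos 0 y
    rw [abs_of_pos (by positivity)]
    refine (div_le_one h4).2 ?_
    rw [h_eq, X0q_zero]
    linarith [K_pos 0]
  have h5 := sqrt_quot_le y
  have h6 : 0 ≤ √(1 + y ^ 2) / √(5 + 4 * y ^ 2) := by positivity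
  set m := √(B₂ x ^ 2 + C₂ x ^ 2) + 2 * (B₂ x / √(B₂ x ^ 2 + C₂ x ^ 2)) * K x
  set m₀ := √(B₂ 0 ^ 2 + C₂ 0 ^ 2) + 2 * (B₂ 0 / √(B₂ 0 ^ 2 + C₂ 0 ^ 2)) * K 0
  set β := B₂ x / √(B₂ x ^ 2 + C₂ x ^ 2)
  set β₀ := B₂ 0 / √(B₂ 0 ^ 2 + C₂ 0 ^ 2)
  set δ := (|K x - K 0| + |X0q x - X0q 0|) / (2 * X0q x)
  set ρ := √(1 + y ^ 2) / √(5 + 4 * y ^ 2)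
  have h7 : |m * (1 / h x y - 1 / h 0 y) + (m - m₀) * (1 / h 0 y) - (β - β₀)| ≤
      |m| * δ + |m - m₀| + |β - β₀| := by
    refine (abs_sub _ _).trans (add_le_add ((abs_add_le _ _).trans (add_le_add ?_ ?_)) le_rfl)
    · rw [abs_mul]; gcongr
    · rw [abs_mul]; exact mul_le_of_le_one_right (abs_nonneg _) h3
  calc _ = |2 * ρ * (m * (1 / h x y - 1 / h 0 y) + (m - m₀) * (1 / h 0 y) - (β - β₀))| := by
        congr 1; ring
    _ = 2 * (ρ * |m * (1 / h x y - 1 / h 0 y) + (m - m₀) * (1 / h 0 y) - (β - β₀)|) := by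
        rw [abs_mul, abs_of_nonneg (by positivity : 0 ≤ 2 * ρ), mul_assoc]
    _ ≤ 2 * |m * (1 / h x y - 1 / h 0 y) + (m - m₀) * (1 / h 0 y) - (β - β₀)| := by
        gcongr; exact mul_le_of_le_one_left (abs_nonneg _) h5
    _ ≤ _ := by gcongr

theorem coeff_uTilde_le (x y : ℝ) :
    |-2 * √(1 + y ^ 2) * C₂ x / (√(B₂ x ^ 2 + C₂ x ^ 2) * √(5 + 4 * y ^ 2))| ≤
      2 * |C₂ x / √(B₂ x ^ 2 + C₂ x ^ 2)| := by
  have h5 := sqrt_quot_le y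
  have h6 : 0 ≤ √(1 + y ^ 2) / √(5 + 4 * y ^ 2) := by positivity
  calc _ = |-2 * (C₂ x / √(B₂ x ^ 2 + C₂ x ^ 2)) * (√(1 + y ^ 2) / √(5 + 4 * y ^ 2))| := by
        congr 1; ring
    _ = 2 * |C₂ x / √(B₂ x ^ 2 + C₂ x ^ 2)| * (√(1 + y ^ 2) / √(5 + 4 * y ^ 2)) := by
        rw [abs_mul, abs_mul, abs_of_nonneg h6]; norm_num
    _ ≤ _ := mul_le_of_le_one_right (by positivity) h5

theorem norm_sub_le_of_coeff {v w w₀ u : E4} (hv : ‖v‖ = 1) (hw : ‖w‖ = 1) (hu : ‖u‖ = 1)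
    (α α₀ β β₀ γ : ℝ) : ‖(α • v + β • w + γ • u) - (α₀ • v + β₀ • w₀)‖ ≤
      |α - α₀| + |β - β₀| + |γ| + |β₀| * ‖w - w₀‖ := by
  calc _ = ‖(α - α₀) • v + (β - β₀) • w + γ • u + β₀ • (w - w₀)‖ := by congr 1; module
    _ ≤ ‖(α - α₀) • v‖ + ‖(β - β₀) • w‖ + ‖γ • u‖ + ‖β₀ • (w - w₀)‖ := norm_add₄_le
    _ = _ := by simp only [norm_smul, hv, hw, hu, mul_one, norm_eq_abs]

theorem IsFrameField.norm_fields {F : ℝ → ℝ → Fin 4 → E4} (hF : IsFrameField F) {x : ℝ}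
    (hx : 0 < x) (y : ℝ) : ‖uField F x y‖ = 1 ∧ ‖vField F x y‖ = 1 ∧ ‖uTildeField F x y‖ = 1 ∧
      ‖vTildeField F x y‖ = 1 := by
  have H := orthonormal_fields (hF.orthonormal x y hx)
  exact ⟨H.1 0, H.1 1, H.1 2, H.1 3⟩

theorem IsFrameField.norm_fField_sub_le {F : ℝ → ℝ → Fin 4 → E4} (hF : IsFrameField F) {x : ℝ}
    (hx : 0 < x) (y s : ℝ) (b c : E4) :
    ‖fField F x y - aCircle b c (vField F 1) s y‖ ≤
      errorBound x + 2 * ‖vTildeField F x 0 - -v2Circle b c s‖ := by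
  obtain ⟨-, hv, hut, hvt⟩ := hF.norm_fields hx y
  have ha : aCircle b c (vField F 1) s y =
      (-(2 / √5 * v₂ 0 y)) • vField F x y + (-(2 / √5 * v₃ 0 y)) • -v2Circle b c s := by
    rw [aCircle, hF.vField_const hx]; module
  rw [fField_eq, ha, ← hF.vTildeField_const hx y]
  refine (norm_sub_le_of_coeff hv hvt hut _ _ _ _ _).trans ?_
  have h1 := coeff_v_sub_le x y
  have h2 := coeff_vTilde_sub_le x y
  have h3 := coeff_uTilde_le x y
  have h4 := mul_le_mul_of_nonneg_right (coeff_vTilde_zero_le y)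
    (norm_nonneg (vTildeField F x y - -v2Circle b c s))
  rw [errorBound, abs_neg]
  linarith

/-- At `x = 0` the normalised pair `(-B₂, C₂)` is `(1, 0)`, so `X_α` and `ũ` have the same
asymptotics; the bound does not involve `y`. -/
theorem IsFrameField.norm_sub_uTildeField_le {F : ℝ → ℝ → Fin 4 → E4} (hF : IsFrameField F)
    {x : ℝ} (hx : 0 < x) (y : ℝ) : ‖F x y 1 - uTildeField F x y‖ ≤
      |1 + B₂ x / √(B₂ x ^ 2 + C₂ x ^ 2)| + |C₂ x / √(B₂ x ^ 2 + C₂ x ^ 2)| := by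
  have hn := (hF.orthonormal x y hx).1
  calc _ = ‖(1 + B₂ x / √(B₂ x ^ 2 + C₂ x ^ 2)) • F x y 1 -
        (C₂ x / √(B₂ x ^ 2 + C₂ x ^ 2)) • F x y 3‖ := by
        congr 1; rw [uTildeField]; match_scalars <;> ring
    _ ≤ _ := by
      refine (norm_sub_le _ _).trans_eq ?_
      rw [norm_smul, norm_smul, hn, hn, mul_one, mul_one, norm_eq_abs, norm_eq_abs]

/-! ### Curvature surfaces -/

theorem radius_le (y : ℝ) : |radius y| ≤ 1 / 2 := by
  have h1 : √((5 + 4 * y ^ 2) / (1 + y ^ 2)) ≤ √5 := by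
    refine sqrt_le_sqrt ?_
    rw [div_le_iff₀ (by positivity)]
    nlinarith [sq_nonneg y]
  have h5 : 0 < √5 := by positivity
  rw [radius, abs_of_nonneg (by positivity)]
  calc _ ≤ 1 / (2 * √5) * √5 := by gcongr
    _ = 1 / 2 := by field_simp

theorem continuous_radius : Continuous radius := by
  have hq : ∀ y : ℝ, 1 + y ^ 2 ≠ 0 := fun y => by positivity
  unfold radius
  fun_prop (disch := exact hq _)

theorem radius_zero : radius 0 = 1 / 2 := by
  have h5 : 0 < √5 := by positivity
  simp [radius]
  field_simp

/-- The `x`-derivatives of `φ`, `X_β` and `ξ` are all multiples of `X_α`, so only one scalar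
identity is at stake; `radius` is the normalisation that makes it hold. -/
theorem IsFrameField.fField_deriv_x {F : ℝ → ℝ → Fin 4 → E4} (hF : IsFrameField F) {x : ℝ}
    (hx : 0 < x) (y : ℝ) : HasDerivAt (fun s => radius y • fField F s y)
      (((x ^ 2 - y ^ 2) / (x * h x y)) • F x y 1) x := by
  have h3 : HasDerivAt (fun s => (2 * (1 + y ^ 2)) • F s y 3)
    ((2 * (1 + y ^ 2)) • b₁ x y • F x y 1) x :=
    (hF.deriv_x_three hx y).const_smul (2 * (1 + y ^ 2))
  have h0 : HasDerivAt (fun s => y • F s y 0) (y • -a₁ x y • F x y 1) x :=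
    (hF.deriv_x_zero hx y).const_smul y
  have hs : HasDerivAt (fun s => F s y 2 - (2 * (1 + y ^ 2)) • F s y 3 + y • F s y 0)
    (c₁ x y • F x y 1 - (2 * (1 + y ^ 2)) • b₁ x y • F x y 1 + y • -a₁ x y • F x y 1) x :=
    ((hF.deriv_x_two hx y).sub h3).add h0
  have hd : HasDerivAt (fun s => fField F s y)
      ((1 / √((1 + y ^ 2) * (5 + 4 * y ^ 2))) • (c₁ x y • F x y 1 -
        (2 * (1 + y ^ 2)) • b₁ x y • F x y 1 + y • -a₁ x y • F x y 1)) x := by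
    unfold fField
    exact hs.const_smul (1 / √((1 + y ^ 2) * (5 + 4 * y ^ 2)))
  refine (hd.const_smul (radius y)).congr_deriv ?_
  have hq : (0 : ℝ) < 1 + y ^ 2 := by positivity
  have hr : (0 : ℝ) < 5 + 4 * y ^ 2 := by positivity
  have hrad : radius y * (1 / √((1 + y ^ 2) * (5 + 4 * y ^ 2))) = 1 / (2 * √5 * (1 + y ^ 2)) := by
    rw [radius, Real.sqrt_mul hq.le, Real.sqrt_div hr.le]
    have h1 := (sqrt_pos.2 hq).ne'
    have h2 := (sqrt_pos.2 hr).ne'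
    field_simp
    rw [sq_sqrt hq.le]
  have hh := (h_pos x y).ne'
  have hx' := hx.ne'
  have h5 : √5 ≠ 0 := by positivity
  have hc : c₁ x y - 2 * (1 + y ^ 2) * b₁ x y - y * a₁ x y =
      2 * √5 * (1 + y ^ 2) * ((x ^ 2 - y ^ 2) / (x * h x y)) := by
    rw [IsFrameField.a₁_eq, b₁, c₁]
    field_simp
    ring
  calc _ = (radius y * (1 / √((1 + y ^ 2) * (5 + 4 * y ^ 2))) *
        (c₁ x y - 2 * (1 + y ^ 2) * b₁ x y - y * a₁ x y)) • F x y 1 := by module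
    _ = _ := by
      rw [hrad, hc]
      congr 1
      field_simp

theorem IsCurvatureSurface.eq_add {F : ℝ → ℝ → Fin 4 → E4} (hF : IsFrameField F)
    {f : ℝ → ℝ → E4} (hf : IsCurvatureSurface F f) {x : ℝ} (hx : 0 < x) (y : ℝ) :
    f x y = radius y • fField F x y + (f 1 y - radius y • fField F 1 y) := by
  have := IsFrameField.const_x (g := fun s => f s y - radius y • fField F s y)
    (fun s hs => ((hf.deriv_x s y hs).sub (hF.fField_deriv_x hs y)).congr_deriv (sub_self _)) hx
  rw [← this]
  module

theorem IsFrameField.continuous_fField {F : ℝ → ℝ → Fin 4 → E4} (hF : IsFrameField F) {x : ℝ}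
    (hx : 0 < x) : Continuous (fField F x) := by
  have hi := fun i => (hF.differentiable_y hx i).continuous
  have hs : ∀ y : ℝ, √((1 + y ^ 2) * (5 + 4 * y ^ 2)) ≠ 0 := fun y => by positivity
  unfold fField
  fun_prop (disch := exact hs _)

/-! ### The limit circles -/

theorem continuous_aCircle (b c : E4) {v : ℝ → E4} (hv : Continuous v) :
    Continuous fun p : ℝ × ℝ => aCircle b c v p.1 p.2 := by
  have hh : Continuous (h 0) := by unfold h; fun_prop
  have hne := fun y => (h_pos 0 y).ne'
  have hR : ∀ y : ℝ, √(5 + 4 * y ^ 2) * h 0 y ≠ 0 := fun y =>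
    mul_ne_zero (by positivity) (hne y)
  have hr : ∀ y : ℝ, 5 + 4 * y ^ 2 ≠ 0 := fun y => by positivity
  have h2 : Continuous (v₂ 0) := by
    unfold v₂
    fun_prop (disch := exact hR _)
  have h3 : Continuous (v₃ 0) := by
    unfold v₃
    fun_prop (disch := first | exact hne _ | exact hr _)
  unfold aCircle v2Circle
  fun_prop

theorem aCircle_zero (b c : E4) (v : ℝ → E4) (s : ℝ) : aCircle b c v s 0 = -v 0 := by
  have h5 : √5 ^ 2 = 5 := sq_sqrt (by norm_num)
  have h0 : 0 < √5 := by positivity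
  have h3 : v₃ 0 0 = 0 := by simp [v₃]
  have h2 : 2 / √5 * v₂ 0 0 = 1 := by
    have : (5 : ℝ) + √5 ≠ 0 := by positivity
    have hh : h 0 0 = 5 + √5 := by rw [h_eq, K_zero, X0q_zero]; ring
    rw [v₂, hh, X0_zero]
    norm_num
    field_simp
    linear_combination -h5
  calc _ = -((2 / √5 * v₂ 0 0) • v 0) := by rw [aCircle, h3]; module
    _ = _ := by rw [h2, one_smul]

theorem tendsto_errorBound : Tendsto (fun s => errorBound (Real.exp (-s))) atTop (𝓝 0) := by
  have := (continuous_errorBound.tendsto 0).comp tendsto_exp_neg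
  rwa [errorBound_zero] at this

theorem tendsto_frame_coeff : Tendsto (fun s : ℝ =>
    |1 + B₂ (Real.exp (-s)) / √(B₂ (Real.exp (-s)) ^ 2 + C₂ (Real.exp (-s)) ^ 2)| +
      |C₂ (Real.exp (-s)) / √(B₂ (Real.exp (-s)) ^ 2 + C₂ (Real.exp (-s)) ^ 2)|)
    atTop (𝓝 0) := by
  have hB := differentiable_B₂.continuous
  have hC := differentiable_C₂.continuous
  have h1 := fun x => (sqrt_pos.2 (B₂_sq_add_pos x)).ne'
  have hc : Continuous fun x => |1 + B₂ x / √(B₂ x ^ 2 + C₂ x ^ 2)| +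
      |C₂ x / √(B₂ x ^ 2 + C₂ x ^ 2)| := by
    fun_prop (disch := exact h1 _)
  have := (hc.tendsto 0).comp tendsto_exp_neg
  have h5 : 1 + √5 ≠ 0 := by positivity
  have h0 : |1 + B₂ 0 / √(B₂ 0 ^ 2 + C₂ 0 ^ 2)| + |C₂ 0 / √(B₂ 0 ^ 2 + C₂ 0 ^ 2)| = 0 := by
    rw [sqrt_zero_eq, B₂_zero, C₂_zero, neg_div, div_self h5]
    simp
  rwa [h0] at this

theorem tendsto_arctan_error : Tendsto (fun y => 2 * |π / 2 - arctan y|) atTop (𝓝 0) := by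
  have h1 : Tendsto arctan atTop (𝓝 (π / 2)) :=
    tendsto_arctan_atTop.mono_right nhdsWithin_le_nhds
  have h2 := ((h1.const_sub (π / 2)).abs).const_mul 2
  simpa using h2

theorem convergesTo_uCurve {b c : E4} (hb : ‖b‖ = 1) (hc : ‖c‖ = 1) :
    ConvergesTo (uCurve b c) (bTildeCircle b c) := by
  refine convergesTo_of_le tendsto_arctan_error fun y => ?_
  -- The limit angle is `y - π/2`; the quarter turn changes `-sin, cos` into `cos, sin`.
  have := norm_circle_sub_le hc (norm_neg b ▸ hb) (y - arctan y) (y - π / 2)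
  rw [cos_sub_pi_div_two, sin_sub_pi_div_two] at this
  rw [show y - arctan y - (y - π / 2) = π / 2 - arctan y by ring] at this
  refine le_of_eq_of_le ?_ this
  rw [uCurve, bTildeCircle]
  congr 1
  module

theorem convergesTo_vCurve {b c : E4} (hb : ‖b‖ = 1) (hc : ‖c‖ = 1) :
    ConvergesTo (vCurve b c) (cTildeCircle b c) := by
  refine convergesTo_of_le tendsto_arctan_error fun y => ?_
  have := norm_circle_sub_le (norm_neg b ▸ hb) (norm_neg c ▸ hc) (y - arctan y) (y - π / 2)
  rw [cos_sub_pi_div_two, sin_sub_pi_div_two] at this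
  rw [show y - arctan y - (y - π / 2) = π / 2 - arctan y by ring] at this
  refine le_of_eq_of_le ?_ this
  rw [vCurve, cTildeCircle]
  congr 1
  module

theorem norm_sub_bCircle_le {b c : E4} (hb : ‖b‖ = 1) (hc : ‖c‖ = 1) (w s : ℝ) :
    ‖(cos w • b + sin w • c) - bCircle b c s‖ ≤ 2 * |w + √5 * s / 2| := by
  have := norm_circle_sub_le hb hc w (-(√5 * s / 2))
  rw [cos_neg, sin_neg, sub_neg_eq_add] at this
  refine le_of_eq_of_le ?_ this
  rw [bCircle]
  congr 1
  module

theorem norm_add_v2Circle_le {b c : E4} (hb : ‖b‖ = 1) (hc : ‖c‖ = 1) (w s : ℝ) :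
    ‖(-(sin w • b) + cos w • c) - -v2Circle b c s‖ ≤ 2 * |w + √5 * s / 2| := by
  have := norm_circle_sub_le hc (norm_neg b ▸ hb) w (-(√5 * s / 2))
  rw [cos_neg, sin_neg, sub_neg_eq_add] at this
  refine le_of_eq_of_le ?_ this
  rw [v2Circle]
  congr 1
  module

theorem tendsto_wTilde_error :
    Tendsto (fun s => 2 * |wTilde (Real.exp (-s)) + √5 * s / 2|) atTop (𝓝 0) := by
  simpa using (tendsto_wTilde.abs).const_mul 2

theorem hasDerivAt_sub_arctan (y : ℝ) :
    HasDerivAt (fun y => y - arctan y) (y ^ 2 / (1 + y ^ 2)) y := by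
  refine ((hasDerivAt_id y).sub (hasDerivAt_arctan y)).congr_deriv ?_
  have : (1 : ℝ) + y ^ 2 ≠ 0 := by positivity
  field_simp
  ring

/-! ### Integration of the two rotations and the constant limit frame. -/

namespace IsFrameField

variable {F : ℝ → ℝ → Fin 4 → E4}

theorem uField_eq_uCurve (hF : IsFrameField F) (y : ℝ) :
    uField F 1 y = uCurve (-vField F 1 0) (uField F 1 0) y ∧
      vField F 1 y = vCurve (-vField F 1 0) (uField F 1 0) y := by
  -- The base point is `0`, where the angle `y - arctan y` vanishes.
  have H := rotation_const isOpen_univ isPreconnected_univ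
    (fun t _ => hF.uField_deriv_y one_pos t) (fun t _ => hF.vField_deriv_y t)
    (fun t _ => hasDerivAt_sub_arctan t) (Set.mem_univ 0) (Set.mem_univ y)
  simp only [arctan_zero, sub_zero, cos_zero, sin_zero, one_smul, zero_smul, zero_add] at H
  rw [uCurve, vCurve]
  constructor
  · rw [H.1]; module
  · rw [H.2]; module

/-- The limit of `ũ` in the frame rotating with `w̃`. -/
def bLimit (F : ℝ → ℝ → Fin 4 → E4) : E4 :=
  cos (wTilde 1) • uTildeField F 1 0 - sin (wTilde 1) • vTildeField F 1 0

/-- The limit of the velocity direction of `ũ` in the frame rotating with `w̃`. -/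
def cLimit (F : ℝ → ℝ → Fin 4 → E4) : E4 :=
  sin (wTilde 1) • uTildeField F 1 0 + cos (wTilde 1) • vTildeField F 1 0

theorem uTildeField_eq_circle (hF : IsFrameField F) {x : ℝ} (hx : 0 < x) :
    uTildeField F x 0 = cos (wTilde x) • bLimit F + sin (wTilde x) • cLimit F ∧
      vTildeField F x 0 = -(sin (wTilde x) • bLimit F) + cos (wTilde x) • cLimit F :=
  rotation_const (S := Set.Ioi 0) (u := fun x => uTildeField F x 0)
    (v := fun x => vTildeField F x 0) isOpen_Ioi isPreconnected_Ioi
    (fun _ ht => hF.uTildeField_deriv_x ht 0) (fun _ ht => hF.vTildeField_deriv_x ht)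
    (fun _ ht => hasDerivAt_wTilde ht) (Set.mem_Ioi.2 one_pos) hx

theorem uTildeField_deriv_exp (hF : IsFrameField F) (s : ℝ) :
    HasDerivAt (fun s => uTildeField F (Real.exp (-s)) 0)
      (-(Real.exp (-s) * T (Real.exp (-s))) • vTildeField F (Real.exp (-s)) 0) s := by
  have h1 : HasDerivAt (fun s : ℝ => Real.exp (-s)) (Real.exp (-s) * -1) s :=
    (hasDerivAt_neg s).exp
  have h2 := HasDerivAt.scomp (g₁ := fun x => uTildeField F x 0) s
    (hF.uTildeField_deriv_x (Real.exp_pos (-s)) 0) h1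
  refine h2.congr_deriv ?_
  module

theorem orthonormal_limit (hF : IsFrameField F) (y : ℝ) :
    Orthonormal ℝ ![uField F 1 y, vField F 1 y, bLimit F, cLimit F] :=
  orthonormal_swap (orthonormal_rotate (orthonormal_swap (hF.orthonormal_const one_pos y)) _)

theorem orthonormal_limit_frame (hF : IsFrameField F) :
    Orthonormal ℝ ![bLimit F, cLimit F, -vField F 1 0, uField F 1 0] := by
  -- A quarter turn carries `(u(0), v(0))` to `(-v(0), u(0))`.
  have := orthonormal_rotate (hF.orthonormal_limit 0) (π / 2)
  rw [cos_pi_div_two, sin_pi_div_two, zero_smul, zero_smul, one_smul, one_smul, zero_sub,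
    add_zero] at this
  exact orthonormal_swap this

end IsFrameField

end

end CurvSurf

/-! ### The theorem. -/

open CurvSurf
theorem theorem3 (F : ℝ → ℝ → Fin 4 → E4) (hF : IsFrameField F) :
    ∃ b c bt ct : E4, Orthonormal ℝ ![b, c, bt, ct] ∧
    ∃ u v ut vt : ℝ → E4,
      -- the vectors `u(y)` and `ũ(x)` of the frame field
      (∀ x y : ℝ, 0 < x → u y = uField F x y) ∧
      (∀ x y : ℝ, 0 < x → ut x = uTildeField F x y) ∧
      -- `u` moves on the unit circle of `span (bt, ct)`, and `v` is its unit velocity direction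
      (∀ y : ℝ, ‖u y‖ = 1 ∧ u y ∈ Submodule.span ℝ {bt, ct}) ∧
      Continuous v ∧
      (∀ y : ℝ, HasDerivAt u ((y ^ 2 / (1 + y ^ 2)) • v y) y) ∧
      (∀ y : ℝ, Orthonormal ℝ ![u y, v y, b, c]) ∧
      -- explicit form of `u` and `v`, and uniqueness of the pair `(bt, ct)`
      (∀ y : ℝ, u y = uCurve bt ct y ∧ v y = vCurve bt ct y) ∧
      (∀ b' c' : E4, Orthonormal ℝ ![b, c, b', c'] →
        (∀ y : ℝ, u y = uCurve b' c' y ∧ v y = vCurve b' c' y) → b' = bt ∧ c' = ct) ∧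
      -- limits of `u` and `v`
      ConvergesTo u (bTildeCircle bt ct) ∧
      ConvergesTo v (cTildeCircle bt ct) ∧
      -- `ũ` moves on the unit circle of `span (b, c)`, and `ṽ` is its unit velocity direction
      (∀ x : ℝ, 0 < x → ‖ut x‖ = 1 ∧ ‖vt x‖ = 1 ∧ ut x ∈ Submodule.span ℝ {b, c}) ∧
      (∀ x : ℝ, 0 < x → 0 < T x) ∧
      (∀ x : ℝ, 0 < x → HasDerivAt ut (T x • vt x) x ∧ HasDerivAt vt (-T x • ut x) x) ∧
      (∀ s : ℝ, HasDerivAt (fun s => ut (Real.exp (-s)))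
        (-(Real.exp (-s) * T (Real.exp (-s))) • vt (Real.exp (-s))) s) ∧
      -- explicit form of `ũ` and `ṽ`
      (∀ x : ℝ, 0 < x → IntervalIntegrable Treg MeasureTheory.volume 0 x) ∧
      (∀ x : ℝ, 0 < x →
        ut x = Real.cos (wTilde x) • b + Real.sin (wTilde x) • c ∧
        vt x = -(Real.sin (wTilde x) • b) + Real.cos (wTilde x) • c) ∧
      -- limits of `ũ` and `ṽ`
      ConvergesTo (fun s => ut (Real.exp (-s))) (bCircle b c) ∧
      ConvergesTo (fun s => vt (Real.exp (-s))) (fun s => -v2Circle b c s) ∧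
      -- limits of `X_α` and of the unit vector field attached to the `x`-curves
      ConvergesToUnif (fun s y => F (Real.exp (-s)) y 1) (fun s _ => bCircle b c s) ∧
      ConvergesToUnif (fun s y => fField F (Real.exp (-s)) y) (aCircle b c v) ∧
      Continuous (fun p : ℝ × ℝ => aCircle b c v p.1 p.2) ∧
      (∀ s : ℝ, aCircle b c v s 0 = -v 0) ∧
      -- limits of the `x`-curves of every curvature surface determined by the frame field
      (∀ f : ℝ → ℝ → E4, IsCurvatureSurface F f →
        ∃ A : ℝ → E4, Continuous A ∧
          (∀ x y : ℝ, 0 < x → f x y = radius y • fField F x y + A y) ∧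
          ConvergesToUnif (fun s y => f (Real.exp (-s)) y)
            (fun s y => radius y • aCircle b c v s y + A y) ∧
          Continuous (fun p : ℝ × ℝ => radius p.2 • aCircle b c v p.1 p.2 + A p.2) ∧
          ∀ s : ℝ, radius 0 • aCircle b c v s 0 + A 0 = -((1 / 2 : ℝ) • v 0) + A 0) := by
  have Hl := hF.orthonormal_limit_frame
  have hb : ‖IsFrameField.bLimit F‖ = 1 := Hl.1 0
  have hc : ‖IsFrameField.cLimit F‖ = 1 := Hl.1 1
  have hbt : ‖-vField F 1 0‖ = 1 := Hl.1 2
  have hct : ‖uField F 1 0‖ = 1 := Hl.1 3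
  have hfConv : ConvergesToUnif (fun s y => fField F (Real.exp (-s)) y)
      (aCircle (IsFrameField.bLimit F) (IsFrameField.cLimit F) (vField F 1)) := by
    refine convergesToUnif_of_le
      (by simpa using tendsto_errorBound.add (tendsto_wTilde_error.const_mul 2)) fun s y => ?_
    refine (hF.norm_fField_sub_le (Real.exp_pos _) y s _ _).trans ?_
    rw [(hF.uTildeField_eq_circle (Real.exp_pos (-s))).2]
    gcongr
    exact norm_add_v2Circle_le hb hc _ _
  have hvc : Continuous (vField F 1) := (hF.differentiable_vField one_pos).continuous
  have hac := continuous_aCircle (IsFrameField.bLimit F) (IsFrameField.cLimit F) hvc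
  refine ⟨IsFrameField.bLimit F, IsFrameField.cLimit F, -vField F 1 0, uField F 1 0, Hl,
    uField F 1, vField F 1, fun x => uTildeField F x 0, fun x => vTildeField F x 0,
    fun x y hx => (hF.uField_const hx y).symm, fun x y hx => (hF.uTildeField_const hx y).symm,
    fun y => ⟨(hF.norm_fields one_pos y).1, ?_⟩, hvc,
    fun y => hF.uField_deriv_y one_pos y, hF.orthonormal_limit, hF.uField_eq_uCurve, ?_, ?_, ?_,
    fun x hx => ⟨(hF.norm_fields hx 0).2.2.1, (hF.norm_fields hx 0).2.2.2, ?_⟩,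
    fun x hx => T_pos hx,
    fun x hx => ⟨hF.uTildeField_deriv_x hx 0, hF.vTildeField_deriv_x hx⟩, fun s => ?_,
    fun x hx => intervalIntegrable_Treg hx, fun x hx => hF.uTildeField_eq_circle hx, ?_, ?_, ?_,
    hfConv, hac, fun s => aCircle_zero _ _ _ s, ?_⟩
  · rw [(hF.uField_eq_uCurve y).1]
    exact Submodule.mem_span_pair.2 ⟨_, _, by rw [uCurve, neg_smul]⟩
  · intro b' c' _ H
    -- At `y = 0` the formulas read `u(0) = c'` and `v(0) = -b'`, which already determines the pair.
    have h0 := H 0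
    simp only [uCurve, vCurve, Real.arctan_zero, sub_zero, Real.cos_zero, Real.sin_zero,
      zero_smul, one_smul, neg_zero, zero_add] at h0
    exact ⟨by rw [h0.2, neg_neg], h0.1.symm⟩
  · intro ε hε
    obtain ⟨U, hU⟩ := convergesTo_uCurve hbt hct ε hε
    refine ⟨U, fun t ht => ?_⟩
    rw [(hF.uField_eq_uCurve t).1]
    exact hU t ht
  · intro ε hε
    obtain ⟨U, hU⟩ := convergesTo_vCurve hbt hct ε hε
    refine ⟨U, fun t ht => ?_⟩
    rw [(hF.uField_eq_uCurve t).2]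
    exact hU t ht
  · beta_reduce
    rw [(hF.uTildeField_eq_circle hx).1]
    exact Submodule.mem_span_pair.2 ⟨_, _, rfl⟩
  · exact hF.uTildeField_deriv_exp s
  · refine convergesTo_of_le tendsto_wTilde_error fun s => ?_
    simp only [(hF.uTildeField_eq_circle (Real.exp_pos (-s))).1]
    exact norm_sub_bCircle_le hb hc _ _
  · refine convergesTo_of_le tendsto_wTilde_error fun s => ?_
    simp only [(hF.uTildeField_eq_circle (Real.exp_pos (-s))).2]
    exact norm_add_v2Circle_le hb hc _ _
  · refine convergesToUnif_of_le
      (by simpa using tendsto_frame_coeff.add tendsto_wTilde_error) fun s y => ?_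
    refine (norm_sub_le_norm_sub_add_norm_sub _ (uTildeField F (Real.exp (-s)) y) _).trans
      (add_le_add (hF.norm_sub_uTildeField_le (Real.exp_pos _) y) ?_)
    rw [hF.uTildeField_const (Real.exp_pos _), (hF.uTildeField_eq_circle (Real.exp_pos (-s))).1]
    exact norm_sub_bCircle_le hb hc _ _
  · intro f hf
    have hA : Continuous fun y => f 1 y - radius y • fField F 1 y := by
      have h1 : Continuous (f 1) := continuous_iff_continuousAt.2 fun y =>
        (hf.deriv_y 1 y one_pos).continuousAt
      exact h1.sub (continuous_radius.smul (hF.continuous_fField one_pos))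
    -- `A(y)` is the difference `f⁰ - r f`, constant in `x`, read off at `x = 1`.
    refine ⟨fun y => f 1 y - radius y • fField F 1 y, hA, fun x y hx => hf.eq_add hF hx y, ?_,
      ((continuous_radius.comp continuous_snd).smul hac).add (hA.comp continuous_snd),
      fun s => ?_⟩
    · intro ε hε
      obtain ⟨U, hU⟩ := hfConv ε hε
      refine ⟨U, fun t ht y => lt_of_le_of_lt ?_ (hU t ht y)⟩
      simp only
      rw [hf.eq_add hF (Real.exp_pos _), add_sub_add_right_eq_sub, ← smul_sub, norm_smul,
        Real.norm_eq_abs]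
      -- As `r ≤ 1/2`, the threshold `U` for the unit field serves the surface too, for all `y` at
      -- once.
      exact mul_le_of_le_one_left (norm_nonneg _) ((radius_le y).trans (by norm_num))
    · rw [aCircle_zero, radius_zero, smul_neg]
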